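/- **Notation.** For a finite simplicial complex $K$ let $\chi(K)$ be its unreduced Euler characteristic. For a finite graph $G$ let $\mathrm{Ind}(G)$ be its independence complex (faces: nonempty independent sets) and $Z(G)=1-\chi(\mathrm{Ind}(G))$. Let $P_m$ be the path with $m$ vertices and $C_n$ the cycle with $n$ vertices ($C_2=P_2$; $P_0$ and $C_0$ are empty), let $P_m\times C_n$ be the cylindrical grid (Cartesian product), and let $$f_n(t)=\sum_{m=0}^\infty Z(P_m\times C_n)\,t^m .$$ **Necklaces.** Let $n$ be an even positive integer and $k\ge 1$. A $(k,n)$-necklace is a set of $2k$ points (stones) on a circle of length $n$, each with a vector from $\{-2,-1,1,2\}$ (positive means clockwise), such that: consecutive stones face in opposite directions; consecutive stones facing away from each other are at odd distance; if two consecutive stones face towards each other, then their distance plus the lengths of their two vectors is odd, their distance is at least $3$, and if it is exactly $3$ then both vectors have length $1$. (The distance of consecutive stones is measured along the arc between them.) Necklaces that differ by an isometry of the circle are identified. The transformation $T$ does the following: all stones jump as dictated by their vectors; then all vectors change by $-2\to1$, $-1\to2$, $1\to-2$, $2\to-1$; then, for any two stones facing each other at distance $3$, their vectors are shortened to length $1$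 where they have length $2$. $\mathrm{Neck}(k,n)$ is the directed graph on the isomorphism classes of $(k,n)$-necklaces with an edge $N\to TN$ for each necklace $N$. **Theorem.** Let $n\ge 0$. 1. If for every $k\ge1$ the length of every directed cycle in $\mathrm{Neck}(k,4n+2)$ divides $4n+2-3k$, then there is a polynomial $h_{4n+2}$ with integer coefficients such that $$f_{4n+2}(t)=\frac{h_{4n+2}(t)}{(1+t^2)\cdot\big[(1-t^{8n-2})(1-t^{8n-8})(1-t^{8n-14})\cdots(1-t^{2n+4})\big]}.$$ 2. If $n=0$, or if for every $k\ge1$ the length of every directed cycle in $\mathrm{Neck}(k,4n)$ divides $4n-3k$, then there is a polynomial $h_{4n}$ with integer coefficients such that $$f_{4n}(t)=\frac{h_{4n}(t)}{(1-t^2)\cdot\big[(1-t^{8n-6})(1-t^{8n-12})(1-t^{8n-18})\cdots(1-t^{2n})\big]}.$$ In both brackets the exponents decrease by $6$ and there are exactly $n$ factors (none for $n=0$). In particular, if for all even $N\ge2$ and all $k\ge1$ every cycle length in $\mathrm{Neck}(k,N)$ divides $N-3k$, then both formulas hold for all $n\ge0$. -/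

import Mathlib

/-! ### The Witten index of the cylindrical grids -/

section WittenIndex

/-- The independence complex `Ind(G)`: its faces are the nonempty finite independent sets. -/
def independenceComplex {V : Type*} (G : SimpleGraph V) : AbstractSimplicialComplex V where
  faces := {s | s.Nonempty ∧ G.IsIndepSet (s : Set V)}
  isRelLowerSet_faces := fun _ hs =>
    ⟨hs.1, fun _ hts ht => ⟨ht, hs.2.mono (Finset.coe_subset.mpr hts)⟩⟩
  singleton_mem := fun v => by simp

open Classical in
/-- The (unreduced) Euler characteristic of an abstract simplicial complex on finitely many
vertices: a face with `d + 1` vertices contributes `(-1) ^ d`. -/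
noncomputable def eulerCharacteristic {V : Type*} [Fintype V]
    (K : AbstractSimplicialComplex V) : ℤ :=
  ∑ s : Finset V with s ∈ K.faces, (-1) ^ (s.card - 1)

/-- The Witten index `Z(G) = 1 - χ(Ind(G))`. -/
noncomputable def wittenIndex {V : Type*} [Fintype V] (G : SimpleGraph V) : ℤ :=
  1 - eulerCharacteristic (independenceComplex G)

/-- The cylindrical grid `P_m × C_n`, where `P_m` is the path with `m` vertices, `C_n` is the
cycle with `n` vertices, `C_2 = P_2`, and `P_0`, `C_0` are empty. -/
def cylinder (m n : ℕ) : SimpleGraph (Fin m × Fin n) :=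
  SimpleGraph.boxProd (SimpleGraph.pathGraph m) (SimpleGraph.cycleGraph n)

/-- The generating function `f_n(t) = ∑_{m ≥ 0} Z(P_m × C_n) t ^ m`. -/
noncomputable def wittenSeries (n : ℕ) : PowerSeries ℤ :=
  PowerSeries.mk fun m => wittenIndex (cylinder m n)

end WittenIndex

/-! ### Necklaces -/

namespace Necklace

/-- A finite set of stones on a circle of length `n`. A stone is a pair: its position on the
circle (the clockwise direction is the positive one) and its stone vector. -/
abbrev Config (n : ℕ) : Type := Finset (ZMod n × ℤ)

/-- The first stone met when going clockwise from the stone `s` is the stone `t`, and the arc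
from `s` to `t` has length `d`. -/
def Consecutive {n : ℕ} (S : Config n) (s t : ZMod n × ℤ) (d : ℕ) : Prop :=
  s ∈ S ∧ t ∈ S ∧ 0 < d ∧ t.1 = s.1 + (d : ZMod n) ∧
    ∀ e : ℕ, 0 < e → e < d → ∀ u ∈ S, u.1 ≠ s.1 + (e : ZMod n)

/-- `s` and `t` are consecutive stones that face towards each other along an arc of length `d`. -/
def FaceTowards {n : ℕ} (S : Config n) (s t : ZMod n × ℤ) (d : ℕ) : Prop :=
  Consecutive S s t d ∧ 0 < s.2 ∧ t.2 < 0

/-- `s` and `t` are consecutive stones that face away from each other along an arc of length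
`d`. -/
def FaceAway {n : ℕ} (S : Config n) (s t : ZMod n × ℤ) (d : ℕ) : Prop :=
  Consecutive S s t d ∧ s.2 < 0 ∧ 0 < t.2

/-- `S` is a `(k, n)`-necklace. -/
structure IsNecklace (k n : ℕ) (S : Config n) : Prop where
  card_eq : S.card = 2 * k
  distinct : ∀ s ∈ S, ∀ t ∈ S, s.1 = t.1 → s = t
  vector_mem : ∀ s ∈ S, s.2 = -2 ∨ s.2 = -1 ∨ s.2 = 1 ∨ s.2 = 2
  opposite : ∀ s t d, Consecutive S s t d → FaceTowards S s t d ∨ FaceAway S s t d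
  away_odd : ∀ s t d, FaceAway S s t d → Odd d
  towards_odd : ∀ s t d, FaceTowards S s t d → Odd (d + s.2.natAbs + t.2.natAbs)
  towards_ge : ∀ s t d, FaceTowards S s t d → 3 ≤ d
  towards_three : ∀ s t, FaceTowards S s t 3 → s.2.natAbs = 1 ∧ t.2.natAbs = 1

/-- The rule by which a stone vector changes after a jump. -/
def turn (a : ℤ) : ℤ :=
  if a = -2 then 1 else if a = -1 then 2 else if a = 1 then -2 else if a = 2 then -1 else a

/-- All stones jump as dictated by their vectors, and then all vectors turn. -/
def jumpTurn {n : ℕ} (S : Config n) : Config n :=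
  S.image fun s => (s.1 + (s.2 : ZMod n), turn s.2)

open Classical in
/-- The vectors of any two stones facing each other in distance `3` get length `1`. -/
noncomputable def fix {n : ℕ} (S : Config n) : Config n :=
  S.image fun s =>
    if (∃ t, FaceTowards S s t 3) ∨ (∃ t, FaceTowards S t s 3) then (s.1, s.2.sign) else s

/-- The necklace transformation `T`. -/
noncomputable def transform {n : ℕ} (S : Config n) : Config n :=
  fix (jumpTurn S)

/-- The isometry `x ↦ ε x + c` of the circle (a rotation for `ε = 1`, a reflection for `ε = -1`),
applied to stones with their vectors. -/
def moveStone {n : ℕ} (ε : ℤˣ) (c : ZMod n) (s : ZMod n × ℤ) : ZMod n × ℤ :=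
  (((ε : ℤ) : ZMod n) * s.1 + c, (ε : ℤ) * s.2)

theorem moveStone_one {n : ℕ} (s : ZMod n × ℤ) : moveStone 1 0 s = s := by
  simp [moveStone]

theorem moveStone_moveStone {n : ℕ} (ε δ : ℤˣ) (c d : ZMod n) (s : ZMod n × ℤ) :
    moveStone δ d (moveStone ε c s) = moveStone (δ * ε) (((δ : ℤ) : ZMod n) * c + d) s := by
  simp only [moveStone, Units.val_mul, Int.cast_mul, Prod.mk.injEq]
  constructor <;> ring

theorem moveStone_inv {n : ℕ} (ε : ℤˣ) (c : ZMod n) (s : ZMod n × ℤ) :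
    moveStone ε (-(((ε : ℤ) : ZMod n) * c)) (moveStone ε c s) = s := by
  rw [moveStone_moveStone, Int.units_mul_self, add_neg_cancel, moveStone_one]

/-- `(k, n)`-necklaces are identified when they differ by an isometry of the circle. -/
def isometrySetoid (k n : ℕ) : Setoid {S : Config n // IsNecklace k n S} where
  r N N' := ∃ (ε : ℤˣ) (c : ZMod n), N'.1 = N.1.image (moveStone ε c)
  iseqv := {
    refl := fun N => ⟨1, 0, by
      rw [Finset.image_congr (g := id) (fun s _ => moveStone_one s), Finset.image_id]⟩
    symm := by
      rintro N N' ⟨ε, c, h⟩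
      refine ⟨ε, -(((ε : ℤ) : ZMod n) * c), ?_⟩
      rw [h, Finset.image_image]
      exact (Finset.image_id.symm.trans
        (Finset.image_congr fun s _ => (moveStone_inv ε c s).symm))
    trans := by
      rintro N N' N'' ⟨ε, c, h⟩ ⟨δ, d, h'⟩
      refine ⟨δ * ε, ((δ : ℤ) : ZMod n) * c + d, ?_⟩
      rw [h', h, Finset.image_image]
      exact Finset.image_congr (fun s _ => moveStone_moveStone ε δ c d s) }

/-- The isomorphism classes of `(k, n)`-necklaces. -/
abbrev Class (k n : ℕ) : Type := Quotient (isometrySetoid k n)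

/-- The necklace graph `Neck(k, n)`: there is a directed edge from the class of each
`(k, n)`-necklace `N` to the class of `T N`. -/
def neckGraph (k n : ℕ) : Digraph (Class k n) where
  Adj a b := ∃ N N' : {S : Config n // IsNecklace k n S},
    a = Quotient.mk _ N ∧ b = Quotient.mk _ N' ∧ N'.1 = transform N.1

/-- The directed graph `G` contains a directed cycle of length `l` (a loop when `l = 1`). -/
def HasCycleOfLength {V : Type*} (G : Digraph V) (l : ℕ) : Prop :=
  0 < l ∧ ∃ c : ZMod l → V, Function.Injective c ∧ ∀ i, G.Adj (c i) (c (i + 1))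

/-- For circumference `n`, and every `k ≥ 1`, the length of every cycle in the graph
`Neck(k, n)` divides `n - 3 k`. -/
def CycleLengthsDivide (n : ℕ) : Prop :=
  ∀ k : ℕ, 1 ≤ k → ∀ l : ℕ, HasCycleOfLength (neckGraph k n) l → (l : ℤ) ∣ (n : ℤ) - 3 * (k : ℤ)

end Necklace

/-! ### Signed counts of independent sets: deletion, domination, isolated edges. -/

section SignedCount

/-! The Witten index is the sum of `(-1) ^ |I|` over the independent sets `I`, so it can be computed
by a transfer method that strips a cylinder column by column. The ragged ends that occur are coded
by states `(A, B)`: the last column is `A` and the one before it is `A ∪ B`. Consecutive elements of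
`A ∪ B` are at distance 2 or 3, and distance 3 only occurs between an element of `A` and one of `B`.

Dominated deletions and isolated edges remove a column and turn `(A, B)` into `(B, successor A B)`,
up to a sign and up to correction terms `(B ∪ R, successor A B \ R)` with `R` nonempty
(`stateCount_succ`). Let `k` be the number of maximal runs of step 2 in `A`. Passing to the
successor keeps `k`, while every correction term has a smaller `k`, so the system of generating
functions is triangular in `k`, with the successor map on the diagonal.

Stones at the two ends of each run of `A`, pointing away from the run with a length that records the
gap to the neighbouring run of `B`, form a `(k, N)`-necklace, and the successor map becomes `T`
(`IsState.transform_stones`). For `k ≥ 1` the necklace determines the state, and isometric states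
have equal counts. Hence, along the successors, the series repeat with a period `l` that is a cycle
length in `Neck(k, N)`, so modulo series of smaller `k` a repeated series `F` satisfies `F = ± t ^ l
F`. If `l` divides `N - 3k`, the factor `1 - t ^ (2 (N - 3k))` clears this denominator. States with
`k = 0` only need `1 - (-1) ^ (N / 2) t ^ 2`, and `4k ≤ N` bounds the number of factors. -/

open Classical in
/-- The signed number of independent subsets of a finite set of vertices. -/
noncomputable def signedCount {V : Type*} (G : SimpleGraph V) (X : Finset V) : ℤ :=
  ∑ I ∈ X.powerset.filter (fun I : Finset V => G.IsIndepSet (I : Set V)), (-1) ^ I.card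

variable {V : Type*} {G : SimpleGraph V}

theorem isIndepSet_insert_iff {v : V} {s : Set V} :
    G.IsIndepSet (insert v s) ↔ G.IsIndepSet s ∧ ∀ w ∈ s, ¬ G.Adj v w := by
  constructor
  · intro h
    refine ⟨h.mono (Set.subset_insert _ _), fun w hw hvw => ?_⟩
    exact h (Set.mem_insert _ _) (Set.mem_insert_of_mem _ hw) hvw.ne hvw
  · rintro ⟨h, h'⟩ x hx y hy hxy hadj
    rcases hx with rfl | hx
    · rcases hy with rfl | hy
      · exact hxy rfl
      · exact h' y hy hadj
    · rcases hy with rfl | hy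
      · exact h' x hx hadj.symm
      · exact h hx hy hxy hadj

theorem signedCount_eq_sum_ite [∀ I : Finset V, Decidable (G.IsIndepSet (I : Set V))]
    (X : Finset V) : signedCount G X =
      ∑ I ∈ X.powerset, if G.IsIndepSet (I : Set V) then (-1) ^ I.card else 0 := by
  rw [signedCount, Finset.sum_filter]
  congr!

open Classical in
/-- Deletion of a vertex. -/
theorem signedCount_insert [DecidableEq V] {v : V} {X : Finset V} (hv : v ∉ X) :
    signedCount G (insert v X) =
      signedCount G X - signedCount G (X.filter fun w => ¬ G.Adj v w) := by
  rw [signedCount_eq_sum_ite, signedCount_eq_sum_ite, signedCount_eq_sum_ite,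
    Finset.sum_powerset_insert hv, sub_eq_add_neg, ← Finset.sum_neg_distrib]
  congr 1
  rw [← Finset.sum_subset (Finset.powerset_mono.2 (Finset.filter_subset (¬ G.Adj v ·) X))]
  · refine Finset.sum_congr rfl fun I hI => ?_
    have hI' : ∀ w ∈ I, w ∈ X ∧ ¬ G.Adj v w := fun w hw =>
      Finset.mem_filter.1 (Finset.mem_powerset.1 hI hw)
    rw [Finset.card_insert_of_notMem fun h => hv (hI' v h).1, pow_succ]
    have h : G.IsIndepSet ((insert v I : Finset V) : Set V) ↔ G.IsIndepSet (I : Set V) := by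
      rw [Finset.coe_insert, isIndepSet_insert_iff]
      exact and_iff_left fun w hw => (hI' w hw).2
    by_cases hI : G.IsIndepSet (I : Set V)
    · rw [if_pos hI, if_pos (h.2 hI)]; ring
    · rw [if_neg hI, if_neg (hI ∘ h.1), neg_zero]
  · intro I hI hI'
    refine if_neg fun h => hI' ?_
    rw [Finset.coe_insert, isIndepSet_insert_iff] at h
    rw [Finset.mem_powerset] at hI ⊢
    exact fun w hw => Finset.mem_filter.2 ⟨hI hw, h.2 w hw⟩

open Classical in
theorem signedCount_eq_zero_of_isolated {u : V} {X : Finset V} (hu : u ∈ X)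
    (h : ∀ w ∈ X, ¬ G.Adj u w) : signedCount G X = 0 := by
  rw [← Finset.insert_erase hu, signedCount_insert (Finset.notMem_erase _ _),
    Finset.filter_true_of_mem, sub_self]
  exact fun w hw => h w (Finset.mem_of_mem_erase hw)

open Classical in
/-- A vertex dominating another one may be deleted. -/
theorem signedCount_insert_of_dominates [DecidableEq V] {u v : V} {X : Finset V} (hv : v ∉ X)
    (hu : u ∈ X)
    (huv : ¬ G.Adj u v) (h : ∀ w ∈ X, G.Adj u w → G.Adj v w) :
    signedCount G (insert v X) = signedCount G X := by
  have h0 : signedCount G (X.filter fun w => ¬ G.Adj v w) = 0 := by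
    refine signedCount_eq_zero_of_isolated (u := u)
      (Finset.mem_filter.2 ⟨hu, fun h' => huv h'.symm⟩) fun w hw hadj => ?_
    rw [Finset.mem_filter] at hw
    exact hw.2 (h w hw.1 hadj)
  rw [signedCount_insert hv, h0, sub_zero]

open Classical in
-- The dominated vertices stay in `X`, so the elements of `R` can be deleted one at a time in any
-- order.
theorem signedCount_union_of_dominated [DecidableEq V] {X R : Finset V} (hd : Disjoint X R)
    (h : ∀ v ∈ R, ∃ u ∈ X, ¬ G.Adj u v ∧ ∀ w ∈ X ∪ R, G.Adj u w → G.Adj v w) :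
    signedCount G (X ∪ R) = signedCount G X := by
  induction R using Finset.induction_on with
  | empty => simp
  | insert v R hv ih =>
    rw [Finset.disjoint_insert_right] at hd
    rw [Finset.union_insert]
    obtain ⟨u, hu, huv, hw⟩ := h v (Finset.mem_insert_self _ _)
    rw [signedCount_insert_of_dominates (u := u) (by simp [hd.1, hv])
      (Finset.mem_union_left _ hu) huv, ih hd.2]
    · intro v' hv'
      obtain ⟨u, hu, huv, hw⟩ := h v' (Finset.mem_insert_of_mem hv')
      refine ⟨u, hu, huv, fun w h' => hw w ?_⟩
      rw [Finset.union_insert]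
      exact Finset.mem_insert_of_mem h'
    · intro w h'
      refine hw w ?_
      rw [Finset.union_insert]
      exact Finset.mem_insert_of_mem h'

open Classical in
/-- An isolated edge contributes the factor `-1`. -/
theorem signedCount_insert_insert [DecidableEq V] {u w : V} {Y : Finset V} (hu : u ∉ Y) (hw : w ∉ Y)
    (huw : G.Adj u w) (hu' : ∀ y ∈ Y, ¬ G.Adj u y) (hw' : ∀ y ∈ Y, ¬ G.Adj w y) :
    signedCount G (insert u (insert w Y)) = - signedCount G Y := by
  rw [signedCount_insert (by simp [hu, huw.ne]),
    signedCount_eq_zero_of_isolated (X := insert w Y) (Finset.mem_insert_self _ _)]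
  · rw [Finset.filter_insert, if_neg (by simpa using huw), Finset.filter_true_of_mem hu', zero_sub]
  · intro y hy
    rcases Finset.mem_insert.1 hy with rfl | hy
    · exact G.irrefl
    · exact hw' y hy

theorem signedCount_map {W : Type*} {H : SimpleGraph W} (e : V ↪ W)
    (he : ∀ x y, H.Adj (e x) (e y) ↔ G.Adj x y) (X : Finset V) :
    signedCount H (X.map e) = signedCount G X := by
  classical
  unfold signedCount
  have hind : ∀ I : Finset V, H.IsIndepSet ((I.map e : Finset W) : Set W) ↔
      G.IsIndepSet (I : Set V) := by
    intro I
    constructor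
    · intro h x hx y hy hxy hadj
      exact h (by simpa using hx) (by simpa using hy) (e.injective.ne hxy) ((he x y).2 hadj)
    · intro h x hx y hy hxy hadj
      simp only [Finset.coe_map, Set.mem_image, Finset.mem_coe] at hx hy
      obtain ⟨x, hx, rfl⟩ := hx
      obtain ⟨y, hy, rfl⟩ := hy
      exact h hx hy (fun h => hxy (by rw [h])) ((he x y).1 hadj)
  symm
  refine Finset.sum_bij (fun I _ => I.map e) ?_ ?_ ?_ ?_
  · intro I hI
    rw [Finset.mem_filter, Finset.mem_powerset] at hI ⊢
    exact ⟨Finset.map_subset_map.2 hI.1, (hind I).2 hI.2⟩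
  · intro I _ J _ h
    exact Finset.map_injective e h
  · intro J hJ
    rw [Finset.mem_filter, Finset.mem_powerset, Finset.subset_map_iff] at hJ
    obtain ⟨⟨I, hI, rfl⟩, hJ⟩ := hJ
    exact ⟨I, by rw [Finset.mem_filter, Finset.mem_powerset]; exact ⟨hI, (hind I).1 hJ⟩, rfl⟩
  · intro I _
    rw [Finset.card_map]

theorem mem_faces_independenceComplex (G : SimpleGraph V) (I : Finset V) :
    I ∈ (independenceComplex G).faces ↔ I.Nonempty ∧ G.IsIndepSet (I : Set V) := Iff.rfl

theorem wittenIndex_eq_signedCount [Fintype V] (G : SimpleGraph V) :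
    wittenIndex G = signedCount G Finset.univ := by
  classical
  have h0 : (∅ : Finset V) ∈ (Finset.univ : Finset V).powerset.filter
      (fun I : Finset V => G.IsIndepSet (I : Set V)) := by
    simp [SimpleGraph.IsIndepSet]
  unfold wittenIndex eulerCharacteristic signedCount
  rw [← Finset.add_sum_erase _ _ h0, Finset.card_empty, pow_zero, sub_eq_add_neg,
    ← Finset.sum_neg_distrib]
  congr 1
  refine Finset.sum_congr ?_ fun I hI => ?_
  · ext I
    simp [mem_faces_independenceComplex, Finset.nonempty_iff_ne_empty]
  · have : I.Nonempty := Finset.nonempty_iff_ne_empty.2 (Finset.mem_erase.1 hI).1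
    obtain ⟨c, hc⟩ := Nat.exists_eq_succ_of_ne_zero this.card_pos.ne'
    rw [hc, Nat.succ_eq_add_one, Nat.add_sub_cancel, pow_succ]
    ring

end SignedCount

/-! ### Ragged cylinders and the removal of one column. -/

section HalfCylinder

/-- The half-infinite cylindrical grid of circumference `N`. -/
def halfCylinder (N : ℕ) : SimpleGraph (ℕ × ZMod N) :=
  SimpleGraph.boxProd (SimpleGraph.hasse ℕ) (SimpleGraph.circulantGraph {1})

/-- `m` full columns, followed by the part `C` of a column and the part `A` of a last column. -/
def ragged {N : ℕ} [NeZero N] (A C : Finset (ZMod N)) (m : ℕ) : Finset (ℕ × ZMod N) :=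
  Finset.range m ×ˢ Finset.univ ∪ {m} ×ˢ C ∪ {m + 1} ×ˢ A

/-- The signed number of independent sets of a ragged cylindrical grid. -/
noncomputable def raggedCount {N : ℕ} [NeZero N] (A C : Finset (ZMod N)) (m : ℕ) : ℤ :=
  signedCount (halfCylinder N) (ragged A C m)

variable {N : ℕ}

theorem mem_ragged [NeZero N] {A C : Finset (ZMod N)} {m i : ℕ} {x : ZMod N} :
    (i, x) ∈ ragged A C m ↔ i < m ∨ (i = m ∧ x ∈ C) ∨ (i = m + 1 ∧ x ∈ A) := by
  simp [ragged, eq_comm, and_comm]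

variable [Fact (1 < N)]

theorem halfCylinder_adj {i j : ℕ} {x y : ZMod N} :
    (halfCylinder N).Adj (i, x) (j, y) ↔
      ((j = i + 1 ∨ i = j + 1) ∧ x = y) ∨ ((x = y + 1 ∨ y = x + 1) ∧ i = j) := by
  have h1 : (1 : ZMod N) ≠ 0 := one_ne_zero
  simp only [halfCylinder, SimpleGraph.boxProd_adj, SimpleGraph.hasse_adj,
    SimpleGraph.circulantGraph_adj, Set.mem_singleton_iff, Nat.covBy_iff_add_one_eq]
  grind

variable [NeZero N]

/-- The new vertex is a leaf hanging on `(m, x)`, so choosing it forbids that one vertex only.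
Solved for the last term, this trades a hole in column `m` for a vertex of column `m + 1`. -/
theorem raggedCount_insert {A C : Finset (ZMod N)} {x : ZMod N} (m : ℕ) (hA : x ∉ A) (hC : x ∈ C)
    (h1 : x + 1 ∉ A) (h2 : x - 1 ∉ A) :
    raggedCount (insert x A) C m = raggedCount A C m - raggedCount A (C.erase x) m := by
  classical
  have e1 : ragged (insert x A) C m = insert (m + 1, x) (ragged A C m) := by
    ext ⟨i, y⟩
    simp only [mem_ragged, Finset.mem_insert, Prod.mk.injEq]
    tauto
  have e2 : (ragged A C m).filter (fun w => ¬ (halfCylinder N).Adj (m + 1, x) w) =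
      ragged A (C.erase x) m := by
    ext ⟨i, y⟩
    have h3 : y ∈ A → x ≠ y + 1 := by rintro h rfl; simp_all
    have h4 : y ∈ A → y ≠ x + 1 := by rintro h rfl; simp_all
    simp only [mem_ragged, Finset.mem_filter, halfCylinder_adj, Finset.mem_erase]
    grind
  unfold raggedCount
  rw [e1, signedCount_insert, e2]
  simp [mem_ragged, hA]

/-- Deletions in the last but one column are traded for vertices of the last column. -/
theorem raggedCount_sdiff {C W : Finset (ZMod N)} (m : ℕ) (hC : W ⊆ C)
    {A : Finset (ZMod N)} (hA : Disjoint W A)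
    (hW : ∀ w ∈ W, w + 1 ∉ A ∪ W ∧ w - 1 ∉ A ∪ W) :
    raggedCount A (C \ W) m = ∑ R ∈ W.powerset, (-1) ^ R.card * raggedCount (A ∪ R) C m := by
  induction W using Finset.induction_on generalizing A with
  | empty => simp
  | insert w W hw ih =>
    rw [Finset.disjoint_insert_left] at hA
    have hw0 := hW w (Finset.mem_insert_self _ _)
    have e : C \ insert w W = (C \ W).erase w := by
      ext y; simp only [Finset.mem_sdiff, Finset.mem_insert, Finset.mem_erase]; tauto
    have h := raggedCount_insert (A := A) (C := C \ W) (x := w) m hA.1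
      (Finset.mem_sdiff.2 ⟨hC (Finset.mem_insert_self _ _), hw⟩)
      (fun h => hw0.1 (Finset.mem_union_left _ h)) (fun h => hw0.2 (Finset.mem_union_left _ h))
    have h' : raggedCount A (C \ insert w W) m =
        raggedCount A (C \ W) m - raggedCount (insert w A) (C \ W) m := by
      rw [e, h]; ring
    rw [h', Finset.sum_powerset_insert hw, ih ((Finset.subset_insert _ _).trans hC) hA.2,
      ih ((Finset.subset_insert _ _).trans hC), sub_eq_add_neg, ← Finset.sum_neg_distrib]
    · congr 1
      refine Finset.sum_congr rfl fun R hR => ?_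
      rw [Finset.card_insert_of_notMem fun h => hw (Finset.mem_powerset.1 hR h), pow_succ,
        Finset.insert_union, Finset.union_insert]
      ring
    · rw [Finset.disjoint_insert_right]
      exact ⟨hw, hA.2⟩
    · intro v hv
      have := hW v (Finset.mem_insert_of_mem hv)
      rwa [Finset.insert_union, ← Finset.union_insert]
    · intro v hv
      have := hW v (Finset.mem_insert_of_mem hv)
      rw [Finset.union_insert] at this
      exact ⟨fun h => this.1 (Finset.mem_insert_of_mem h),
        fun h => this.2 (Finset.mem_insert_of_mem h)⟩

/-- Each pair `(m + 1, a)`, `(m + 2, a)` is an isolated edge: `(m, a)` is missing because `a ∉ S`,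
and the vertical neighbours are missing because `A ∪ B` is independent. -/
theorem signedCount_union_rungs {A B S : Finset (ZMod N)} (m : ℕ) (hS : Disjoint A S)
    (hB : Disjoint A B) (hA : ∀ x ∈ A ∪ B, x + 1 ∉ A ∪ B) :
    signedCount (halfCylinder N) (ragged B S m ∪ ({m + 1} ×ˢ A ∪ {m + 2} ×ˢ A)) =
      (-1) ^ A.card * raggedCount B S m := by
  classical
  induction A using Finset.induction_on with
  | empty => simp [raggedCount]
  | insert a A ha ih =>
    rw [Finset.disjoint_insert_left] at hS hB
    have e : ragged B S m ∪ ({m + 1} ×ˢ insert a A ∪ {m + 2} ×ˢ insert a A) =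
        insert (m + 2, a) (insert (m + 1, a)
          (ragged B S m ∪ ({m + 1} ×ˢ A ∪ {m + 2} ×ˢ A))) := by
      ext ⟨i, y⟩
      simp only [mem_ragged, Finset.mem_insert, Prod.mk.injEq, Finset.mem_union,
        Finset.mem_product, Finset.mem_singleton]
      clear * -
      by_cases h1 : i = m + 1 <;> by_cases h2 : i = m + 2 <;> simp [h1, h2, or_comm, or_left_comm]
    have h1 : ∀ x ∈ A ∪ B, x ≠ a + 1 := by
      rintro x hx rfl
      refine hA a (by simp) ?_
      rw [Finset.insert_union]
      exact Finset.mem_insert_of_mem hx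
    have h2 : ∀ x ∈ A ∪ B, a ≠ x + 1 := by
      rintro x hx h
      refine hA x (by rw [Finset.insert_union]; exact Finset.mem_insert_of_mem hx) ?_
      rw [← h]; simp
    rw [e, signedCount_insert_insert, ih hS.2 hB.2, Finset.card_insert_of_notMem ha]
    · ring
    · intro x hx h
      refine hA x ?_ ?_ <;> rw [Finset.insert_union] <;> exact Finset.mem_insert_of_mem ‹_›
    · simp [mem_ragged, ha]
    · simp [mem_ragged, ha, hB.1]
    · rw [halfCylinder_adj]; simp
    · rintro ⟨i, y⟩ hy
      have h1' := h1 y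
      have h2' := h2 y
      simp only [mem_ragged, Finset.mem_union, Finset.mem_product,
        Finset.mem_singleton] at hy h1' h2'
      rw [halfCylinder_adj]
      rcases hy with (hy | ⟨rfl, hy⟩ | ⟨rfl, hy⟩) | ⟨rfl, hy⟩ | ⟨rfl, hy⟩
      · omega
      · simp; omega
      · simp [h1' (Or.inr hy), h2' (Or.inr hy), show a ≠ y by rintro rfl; exact hB.1 hy]
      · simp [h1' (Or.inl hy), h2' (Or.inl hy), show a ≠ y by rintro rfl; exact ha hy]
      · simp [h1' (Or.inl hy), h2' (Or.inl hy), show a ≠ y by rintro rfl; exact ha hy]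
    · rintro ⟨i, y⟩ hy
      have h1' := h1 y
      have h2' := h2 y
      simp only [mem_ragged, Finset.mem_union, Finset.mem_product,
        Finset.mem_singleton] at hy h1' h2'
      rw [halfCylinder_adj]
      rcases hy with (hy | ⟨rfl, hy⟩ | ⟨rfl, hy⟩) | ⟨rfl, hy⟩ | ⟨rfl, hy⟩
      · omega
      · simp [show a ≠ y by rintro rfl; exact hS.1 hy]
      · simp [h1' (Or.inr hy), h2' (Or.inr hy), show a ≠ y by rintro rfl; exact hB.1 hy]
      · simp [h1' (Or.inl hy), h2' (Or.inl hy), show a ≠ y by rintro rfl; exact ha hy]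
      · simp [h1' (Or.inl hy), h2' (Or.inl hy), show a ≠ y by rintro rfl; exact ha hy]

/-- Removal of a column. -/
theorem raggedCount_succ {A B S : Finset (ZMod N)} (m : ℕ) (hB : Disjoint A B)
    (hA : ∀ x ∈ A ∪ B, x + 1 ∉ A ∪ B)
    (hS : ∀ x, x ∈ S ↔ x ∉ A ∧ x - 1 ∉ B ∧ x + 1 ∉ B) :
    raggedCount A (A ∪ B) (m + 1) = (-1) ^ A.card * raggedCount B S m := by
  classical
  rw [← signedCount_union_rungs m _ hB hA]
  · have e : ragged A (A ∪ B) (m + 1) =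
        (ragged B S m ∪ ({m + 1} ×ˢ A ∪ {m + 2} ×ˢ A)) ∪ {m} ×ˢ Sᶜ := by
      ext ⟨i, y⟩
      simp only [mem_ragged, Finset.mem_union, Finset.mem_product, Finset.mem_singleton,
        Finset.mem_compl, Nat.lt_succ_iff_lt_or_eq]
      clear hS hA hB
      by_cases h1 : y ∈ A <;> by_cases h2 : y ∈ S <;> simp only [h1, h2, true_or, and_true, and_false,
        false_or, or_false, not_true, not_false_eq_true] <;> grind
    unfold raggedCount
    rw [e]
    refine signedCount_union_of_dominated ?_ ?_
    · rw [Finset.disjoint_left]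
      rintro ⟨i, y⟩
      simp only [mem_ragged, Finset.mem_union, Finset.mem_product, Finset.mem_singleton,
        Finset.mem_compl]
      rintro ((h | ⟨h, h'⟩ | ⟨h, h'⟩) | ⟨h, h'⟩ | ⟨h, h'⟩) ⟨h1, h2⟩
      · omega
      · exact h2 h'
      all_goals omega
    · rintro ⟨i, y⟩ hy
      rw [← e]
      simp only [Finset.mem_product, Finset.mem_singleton, Finset.mem_compl, hS] at hy
      obtain ⟨rfl, hy⟩ := hy
      -- Two kinds of leaves force deletions in the full column `i`. For `y ∈ A` the only neighbour
      -- of `(i + 2, y)` is `(i + 1, y)`, which is adjacent to `(i, y)`. For `b ∈ B` the only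
      -- neighbour of `(i + 1, b)` is `(i, b)`, which is adjacent to `(i, b ± 1)`.
      by_cases hyA : y ∈ A
      · refine ⟨(i + 2, y), ?_, ?_, ?_⟩
        · simp [hyA]
        · rw [halfCylinder_adj]; simp; omega
        · rintro ⟨j, x⟩ hx
          have h1 : x ∈ A ∪ B → x + 1 ∉ A ∪ B := hA x
          have h2 : y + 1 ∉ A ∪ B := hA y (Finset.mem_union_left _ hyA)
          simp only [mem_ragged, Finset.mem_union] at hx h1 h2
          rw [halfCylinder_adj, halfCylinder_adj]
          grind
      · have hb : ∃ b ∈ B, y = b + 1 ∨ b = y + 1 := by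
          by_cases h : y - 1 ∈ B
          · exact ⟨_, h, Or.inl (by ring)⟩
          · exact ⟨y + 1, by tauto, Or.inr rfl⟩
        obtain ⟨b, hb, hby⟩ := hb
        refine ⟨(i + 1, b), ?_, ?_, ?_⟩
        · simp [mem_ragged, hb]
        · rw [halfCylinder_adj]
          have h1 : (1 : ZMod N) ≠ 0 := one_ne_zero
          grind
        · rintro ⟨j, x⟩ hx
          have h1 : x ∈ A ∪ B → x + 1 ∉ A ∪ B := hA x
          have h2 : b + 1 ∉ A ∪ B := hA b (Finset.mem_union_right _ hb)
          have h3 : b ∉ A := fun h => Finset.disjoint_left.1 hB h hb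
          simp only [mem_ragged, Finset.mem_union] at hx h1 h2
          rw [halfCylinder_adj, halfCylinder_adj]
          grind
  · rw [Finset.disjoint_left]
    intro x hx hxS
    exact ((hS x).1 hxS).1 hx

theorem raggedCount_map (e : ZMod N ≃ ZMod N) (he : ∀ x y, (e x = e y + 1 ∨ e y = e x + 1) ↔
    (x = y + 1 ∨ y = x + 1)) (A C : Finset (ZMod N)) (m : ℕ) :
    raggedCount (A.map e.toEmbedding) (C.map e.toEmbedding) m = raggedCount A C m := by
  unfold raggedCount
  refine Eq.trans ?_
    (signedCount_map ((Equiv.refl ℕ).prodCongr e).toEmbedding (H := halfCylinder N) ?_ _)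
  · congr 1
    ext ⟨i, x⟩
    obtain ⟨y, rfl⟩ := e.surjective x
    simp only [mem_ragged, Finset.mem_map, Equiv.coe_toEmbedding, Prod.exists,
      Equiv.prodCongr_apply, Prod.map, Equiv.refl_apply, Prod.mk.injEq, e.injective.eq_iff]
    simp
  · rintro ⟨i, x⟩ ⟨j, y⟩
    simp only [Equiv.coe_toEmbedding, Equiv.prodCongr_apply, Prod.map, Equiv.refl_apply,
      halfCylinder_adj, he, e.injective.eq_iff]

theorem wittenIndex_cylinder (m : ℕ) : wittenIndex (cylinder m N) = raggedCount (N := N) ∅ ∅ m := by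
  -- In this form `ZMod N` unfolds to `Fin (n + 2)`, the vertex type for which
  -- `SimpleGraph.cycleGraph_adj` is stated.
  obtain ⟨n, rfl⟩ : ∃ n, N = n + 2 := ⟨N - 2, by have := (Fact.out : 1 < N); omega⟩
  rw [wittenIndex_eq_signedCount, raggedCount]
  let e : Fin m × Fin (n + 2) ↪ ℕ × ZMod (n + 2) :=
    ⟨fun p => (p.1.val, p.2), fun p q h => by
      have h' := Prod.ext_iff.1 h
      exact Prod.ext (Fin.ext h'.1) h'.2⟩
  rw [← signedCount_map e (H := halfCylinder (n + 2))]
  · congr 1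
    ext ⟨i, x⟩
    simp only [Finset.mem_map, Finset.mem_univ, true_and, mem_ragged, Finset.notMem_empty, and_false,
      or_false]
    constructor
    · rintro ⟨⟨j, y⟩, h⟩
      have := (Prod.mk.inj h).1
      have := j.2
      simp_all
    · intro h
      exact ⟨(⟨i, h⟩, x), rfl⟩
  · rintro ⟨i, x⟩ ⟨j, y⟩
    refine (halfCylinder_adj (N := n + 2) (i := i.val) (j := j.val) (x := x) (y := y)).trans ?_
    rw [cylinder, SimpleGraph.boxProd_adj, SimpleGraph.pathGraph_adj, SimpleGraph.cycleGraph_adj]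
    refine or_congr (and_congr_left' (by simp only [eq_comm])) (and_congr ?_ Fin.ext_iff.symm)
    exact or_congr (sub_eq_iff_eq_add'.symm.trans (by rfl)) (sub_eq_iff_eq_add'.symm.trans (by rfl))

end HalfCylinder

/-! ### States and their successors. -/

section LadderStates

variable {N : ℕ}

/-- The pairs of consecutive last columns that occur in the recursion. -/
structure IsState (A B : Finset (ZMod N)) : Prop where
  disj : ∀ x ∈ A, x ∉ B
  indep : ∀ x, x ∈ A ∨ x ∈ B → x + 1 ∉ A ∧ x + 1 ∉ B
  dense : ∀ x, (x - 1 ∈ A ∨ x - 1 ∈ B) ∨ (x ∈ A ∨ x ∈ B) ∨ (x + 1 ∈ A ∨ x + 1 ∈ B)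
  left : ∀ x ∈ A, x + 3 ∉ A
  right : ∀ x ∈ B, x + 3 ∉ B

open Classical in
/-- The vertices that may be moved between the two columns. -/
noncomputable def exchangeable (A B : Finset (ZMod N)) : Finset (ZMod N) :=
  A.filter fun x => x - 2 ∈ B ∧ x + 2 ∈ B

open Classical in
/-- The free vertices of a column after the removal of the preceding one. -/
noncomputable def freeVertices [NeZero N] (A B : Finset (ZMod N)) : Finset (ZMod N) :=
  Finset.univ.filter fun x => x ∉ A ∧ x ∉ B ∧ x - 1 ∉ B ∧ x + 1 ∉ B

/-- The second component of the successor `(B, _)` of the state `(A, B)`. -/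
noncomputable def successor [NeZero N] (A B : Finset (ZMod N)) : Finset (ZMod N) :=
  freeVertices A B ∪ exchangeable A B

variable {A B : Finset (ZMod N)}

theorem mem_exchangeable {x : ZMod N} :
    x ∈ exchangeable A B ↔ x ∈ A ∧ x - 2 ∈ B ∧ x + 2 ∈ B := by
  simp [exchangeable]

theorem mem_successor [NeZero N] {x : ZMod N} :
    x ∈ successor A B ↔ (x ∉ A ∧ x ∉ B ∧ x - 1 ∉ B ∧ x + 1 ∉ B) ∨
      (x ∈ A ∧ x - 2 ∈ B ∧ x + 2 ∈ B) := by
  simp [successor, exchangeable, freeVertices]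

theorem IsState.symm (h : IsState A B) : IsState B A where
  disj x hx hx' := h.disj x hx' hx
  indep x hx := (h.indep x hx.symm).symm
  dense x := by have := h.dense x; tauto
  left := h.right
  right := h.left

/-- All the conditions on a state at one place. -/
theorem IsState.facts (h : IsState A B) (x : ZMod N) :
    (x ∈ A → x ∉ B ∧ x + 3 ∉ A) ∧ (x ∈ B → x ∉ A ∧ x + 3 ∉ B) ∧
      (x ∈ A ∨ x ∈ B → x + 1 ∉ A ∧ x + 1 ∉ B) ∧
      ((x - 1 ∈ A ∨ x - 1 ∈ B) ∨ (x ∈ A ∨ x ∈ B) ∨ (x + 1 ∈ A ∨ x + 1 ∈ B)) :=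
  ⟨fun hx => ⟨h.disj x hx, h.left x hx⟩, fun hx => ⟨fun hx' => h.disj x hx' hx, h.right x hx⟩,
    h.indep x, h.dense x⟩

variable [NeZero N]

/-- Exchangeable vertices have to be put back for `dense`: if `x ∈ A` and `x ± 2 ∈ B`, then none of
`x - 1`, `x`, `x + 1` is free or in `B`. -/
theorem IsState.next (h : IsState A B) : IsState B (successor A B) where
  disj x hx := by
    have h1 := h.disj x
    rw [mem_successor]
    tauto
  indep x hx := by
    have i0 := h.facts x
    have i1 := h.facts (x - 1)
    have i2 := h.facts (x + 1)
    simp only [mem_successor] at *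
    ring_nf at *
    grind
  dense x := by
    have i0 := h.facts x
    have i1 := h.facts (x - 1)
    have i2 := h.facts (x + 1)
    have i3 := h.facts (x - 2)
    have i4 := h.facts (x + 2)
    simp only [mem_successor] at *
    ring_nf at *
    grind
  left := h.right
  right x hx hx' := by
    rw [mem_successor] at *
    have h0 := h.facts (x - 2)
    have h1 := h.facts (x - 1)
    have h2 := h.facts x
    have h3 := h.facts (x + 1)
    have h4 := h.facts (x + 2)
    have h5 := h.facts (x + 3)
    have h6 := h.facts (x + 4)
    ring_nf at *
    grind

end LadderStates

/-! ### Exchanges, runs of step 2, and the recursion for the counts. -/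

section LadderStates

variable {N : ℕ} {A B : Finset (ZMod N)}

/-- The union of the two sets does not change, so only `left` is in question. An element `r` of `R`
has `r ± 2 ∈ A`, so by independence `r ± 3 ∉ A`, and two elements of `R ⊆ B` are never at distance
3. -/
theorem IsState.exchange (h : IsState A B) {R : Finset (ZMod N)} (hR : R ⊆ exchangeable B A) :
    IsState (A ∪ R) (B \ R) := by
  have hR' : ∀ x, x ∈ R → x ∈ B ∧ x - 2 ∈ A ∧ x + 2 ∈ A := fun x hx => mem_exchangeable.1 (hR hx)
  have key : ∀ x, (x ∈ A ∪ R ∨ x ∈ B \ R) ↔ (x ∈ A ∨ x ∈ B) := by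
    intro x
    have := hR' x
    rw [Finset.mem_union, Finset.mem_sdiff]
    tauto
  refine ⟨fun x hx => ?_, fun x hx => ?_, fun x => ?_, fun x hx => ?_, fun x hx => ?_⟩
  · have := h.disj x
    rw [Finset.mem_union] at hx
    rw [Finset.mem_sdiff]
    tauto
  · have h1 := h.indep x ((key x).1 hx)
    have h2 := key (x + 1)
    tauto
  · simp only [key]
    exact h.dense x
  · have h0 := h.facts x
    have h1 := h.facts (x + 2)
    have h2 := h.facts (x + 1)
    have r1 := hR' x
    have r2 := hR' (x + 3)
    simp only [Finset.mem_union] at *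
    ring_nf at *
    grind
  · rw [Finset.mem_sdiff] at *
    exact fun h' => h.right x hx.1 h'.1

open Classical in
/-- The elements of `A` at which a run of step `2` begins. -/
noncomputable def runStarts (A : Finset (ZMod N)) : Finset (ZMod N) :=
  A.filter fun x => x - 2 ∉ A

open Classical in
/-- The elements of `A` at which a run of step `2` ends. -/
noncomputable def runEnds (A : Finset (ZMod N)) : Finset (ZMod N) :=
  A.filter fun x => x + 2 ∉ A

theorem mem_runStarts {x : ZMod N} : x ∈ runStarts A ↔ x ∈ A ∧ x - 2 ∉ A := by
  simp [runStarts]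

theorem mem_runEnds {x : ZMod N} : x ∈ runEnds A ↔ x ∈ A ∧ x + 2 ∉ A := by
  simp [runEnds]

/-- Translation by 2 matches the elements of `A` that are not ends with those that are not starts.
-/
theorem card_runEnds (A : Finset (ZMod N)) : (runEnds A).card = (runStarts A).card := by
  classical
  have h1 := Finset.card_filter_add_card_filter_not (s := A) fun x => x - 2 ∈ A
  have h2 := Finset.card_filter_add_card_filter_not (s := A) fun x => x + 2 ∈ A
  have h3 : (A.filter fun x => x + 2 ∈ A).card = (A.filter fun x => x - 2 ∈ A).card := by
    refine Finset.card_bij (fun x _ => x + 2) ?_ ?_ ?_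
    · intro x hx
      rw [Finset.mem_filter] at *
      simpa using hx.symm
    · intro x _ y _ hxy
      simpa using hxy
    · intro x hx
      rw [Finset.mem_filter] at hx
      exact ⟨x - 2, by simp [hx], by simp⟩
  unfold runEnds runStarts
  omega

/-- A moved element `r` merges the run ending at `r - 2` with the run starting at `r + 2`: the start
`r + 2` is lost and no new start appears. -/
theorem IsState.card_runStarts_exchange_lt (h : IsState A B) {R : Finset (ZMod N)}
    (hR : R ⊆ exchangeable B A) (hne : R.Nonempty) :
    (runStarts (A ∪ R)).card < (runStarts A).card := by
  have hR' : ∀ x, x ∈ R → x ∈ B ∧ x - 2 ∈ A ∧ x + 2 ∈ A := fun x hx => mem_exchangeable.1 (hR hx)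
  refine Finset.card_lt_card ?_
  rw [Finset.ssubset_iff_of_subset]
  · obtain ⟨r, hr⟩ := hne
    have h0 := hR' r hr
    refine ⟨r + 2, ?_, ?_⟩
    · rw [mem_runStarts, add_sub_cancel_right]
      exact ⟨h0.2.2, fun h' => h.disj r h' h0.1⟩
    · rw [mem_runStarts, add_sub_cancel_right]
      exact fun h' => h'.2 (Finset.mem_union_right _ hr)
  · intro x hx
    rw [mem_runStarts, Finset.mem_union, Finset.mem_union] at *
    have := hR' x
    tauto

/-- After the end `x` of a run of `A`, the next element of `A ∪ B` is `x + 2` or `x + 3`. It lies in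
`B` and starts a run there. Two ends with the same image would be equal or adjacent. -/
theorem IsState.card_runStarts_le (h : IsState A B) :
    (runStarts A).card ≤ (runStarts B).card := by
  classical
  rw [← card_runEnds A]
  refine Finset.card_le_card_of_injOn (fun x => if x + 2 ∈ B then x + 2 else x + 3) ?_ ?_
  · intro x hx
    rw [Finset.mem_coe, mem_runEnds] at hx
    rw [Finset.mem_coe, mem_runStarts]
    have h0 := h.facts x
    have h1 := h.facts (x + 1)
    have h2 := h.facts (x + 2)
    ring_nf at *
    split_ifs with hB <;> ring_nf <;> grind
  · intro x hx y hy hxy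
    rw [Finset.mem_coe, mem_runEnds] at hx hy
    have h0 := h.indep x
    have h1 := h.indep y
    have e1 : x + 2 = y + 3 → x = y + 1 := fun e => by linear_combination e
    have e2 : x + 3 = y + 2 → y = x + 1 := fun e => by linear_combination -e
    dsimp only at hxy
    split_ifs at hxy with h3 h4 h4
    · simpa using hxy
    · have := e1 hxy; subst this; tauto
    · have := e2 hxy; subst this; tauto
    · simpa using hxy

theorem IsState.card_runStarts_eq (h : IsState A B) :
    (runStarts B).card = (runStarts A).card :=
  le_antisymm h.symm.card_runStarts_le h.card_runStarts_le

variable [NeZero N]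

/-- `A` and `B` have equally many runs, hence each has at least that many elements, and `A ∪ B` is
disjoint from its translate by 1. -/
theorem IsState.four_mul_card_runStarts_le (h : IsState A B) : 4 * (runStarts A).card ≤ N := by
  classical
  have h1 : (runStarts A).card ≤ A.card := Finset.card_filter_le _ _
  have h2 : (runStarts B).card ≤ B.card := Finset.card_filter_le _ _
  have h3 : (A ∪ B).card = A.card + B.card :=
    Finset.card_union_of_disjoint (Finset.disjoint_left.2 h.disj)
  have h4 : ((A ∪ B) ∪ (A ∪ B).map (Equiv.addRight (1 : ZMod N)).toEmbedding).card =
      (A ∪ B).card + (A ∪ B).card := by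
    rw [Finset.card_union_of_disjoint, Finset.card_map]
    rw [Finset.disjoint_left]
    intro x hx hx'
    obtain ⟨y, hy, rfl⟩ := Finset.mem_map.1 hx'
    have := h.indep y (Finset.mem_union.1 hy)
    have := Finset.mem_union.1 hx
    simp at this
    tauto
  have h5 := Finset.card_le_univ ((A ∪ B) ∪ (A ∪ B).map (Equiv.addRight (1 : ZMod N)).toEmbedding)
  rw [ZMod.card] at h5
  have h6 := h.card_runStarts_eq
  omega

/-- The signed numbers of independent sets belonging to a state. -/
noncomputable def stateCount (A B : Finset (ZMod N)) (m : ℕ) : ℤ :=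
  raggedCount A (A ∪ B) m

/-- Removing a column leaves `B ∪ successor A B` with holes at the exchangeable vertices.
`raggedCount_sdiff` fills the holes at the price of the sum over `R`. -/
theorem stateCount_succ [Fact (1 < N)] (h : IsState A B) (m : ℕ) :
    stateCount A B (m + 1) = (-1) ^ A.card * ∑ R ∈ (exchangeable A B).powerset,
      (-1) ^ R.card * stateCount (B ∪ R) (successor A B \ R) m := by
  classical
  have hs := h.next
  have hE : exchangeable A B ⊆ successor A B := Finset.subset_union_right
  rw [stateCount, raggedCount_succ (S := (B ∪ successor A B) \ exchangeable A B) m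
    (Finset.disjoint_left.2 h.disj) (by simpa using fun x => h.indep x)]
  · rw [raggedCount_sdiff m (hE.trans Finset.subset_union_right)]
    · congr 1
      refine Finset.sum_congr rfl fun R hR => ?_
      rw [stateCount]
      congr 2
      ext x
      have : x ∈ R → x ∈ successor A B := fun hx => hE (Finset.mem_powerset.1 hR hx)
      simp only [Finset.mem_union, Finset.mem_sdiff]
      tauto
    · rw [Finset.disjoint_left]
      exact fun x hx hx' => h.disj x (mem_exchangeable.1 hx).1 hx'
    · intro x hx
      have h1 := mem_exchangeable.1 hx
      have h2 := h.facts x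
      have h3 := h.facts (x - 1)
      simp only [Finset.mem_union, mem_exchangeable]
      ring_nf at *
      grind
  · intro x
    have h0 := h.facts x
    have h1 := h.facts (x - 1)
    have h2 := h.facts (x + 1)
    simp only [Finset.mem_union, Finset.mem_sdiff, mem_exchangeable, mem_successor]
    ring_nf at *
    grind

theorem IsState.union_successor_sdiff (h : IsState A B) {R : Finset (ZMod N)}
    (hR : R ⊆ exchangeable A B) : IsState (B ∪ R) (successor A B \ R) := by
  refine h.next.exchange fun x hx => ?_
  have := mem_exchangeable.1 (hR hx)
  rw [mem_exchangeable, mem_successor]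
  tauto

theorem IsState.card_runStarts_union_lt (h : IsState A B) {R : Finset (ZMod N)}
    (hR : R ⊆ exchangeable A B) (hne : R.Nonempty) :
    (runStarts (B ∪ R)).card < (runStarts A).card := by
  rw [← h.card_runStarts_eq]
  refine h.next.card_runStarts_exchange_lt (fun x hx => ?_) hne
  have := mem_exchangeable.1 (hR hx)
  rw [mem_exchangeable, mem_successor]
  tauto

end LadderStates

/-! ### Isometries, the initial states, and states without runs. -/

section LadderStates

variable {N : ℕ} {A B : Finset (ZMod N)}

/-- The isometry of the circle of states that corresponds to `Necklace.moveStone ε c`. -/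
def stateIsometry (ε : ℤˣ) (c : ZMod N) : ZMod N ≃ ZMod N :=
  if ε = 1 then Equiv.addRight c else Equiv.subLeft (c - 1)

theorem stateIsometry_one (c x : ZMod N) : stateIsometry 1 c x = x + c := by
  simp [stateIsometry]

/-- The shift by 1 arises because an element `x` stands for the arc from `x` to `x + 1`, with stones
at the ends of runs of such arcs. The reflection `p ↦ c - p` carries this arc to the one beginning
at `c - 1 - x`. -/
theorem stateIsometry_neg_one (c x : ZMod N) : stateIsometry (-1) c x = c - 1 - x := by
  have : (-1 : ℤˣ) ≠ 1 := by decide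
  simp [stateIsometry, this]

theorem mem_map_stateIsometry_one {c x : ZMod N} :
    x ∈ A.map (stateIsometry 1 c).toEmbedding ↔ x - c ∈ A := by
  simp only [Finset.mem_map, Equiv.coe_toEmbedding, stateIsometry_one]
  constructor
  · rintro ⟨y, hy, rfl⟩
    simpa using hy
  · exact fun h => ⟨_, h, by ring⟩

theorem mem_map_stateIsometry_neg_one {c x : ZMod N} :
    x ∈ A.map (stateIsometry (-1) c).toEmbedding ↔ c - 1 - x ∈ A := by
  simp only [Finset.mem_map, Equiv.coe_toEmbedding, stateIsometry_neg_one]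
  constructor
  · rintro ⟨y, hy, rfl⟩
    simpa using hy
  · exact fun h => ⟨_, h, by ring⟩

theorem stateCount_map [NeZero N] [Fact (1 < N)] (ε : ℤˣ) (c : ZMod N) (m : ℕ) :
    stateCount (A.map (stateIsometry ε c).toEmbedding) (B.map (stateIsometry ε c).toEmbedding) m =
      stateCount A B m := by
  classical
  rw [stateCount, ← Finset.map_union, raggedCount_map, stateCount]
  intro x y
  rcases Int.units_eq_one_or ε with rfl | rfl
  · simp only [stateIsometry_one]
    grind
  · simp only [stateIsometry_neg_one]
    grind

theorem IsState.map (h : IsState A B) (ε : ℤˣ) (c : ZMod N) :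
    IsState (A.map (stateIsometry ε c).toEmbedding) (B.map (stateIsometry ε c).toEmbedding) := by
  rcases Int.units_eq_one_or ε with rfl | rfl
  · refine ⟨?_, ?_, ?_, ?_, ?_⟩ <;> intro x <;> simp only [mem_map_stateIsometry_one]
    · exact h.disj _
    · have := h.indep (x - c)
      ring_nf at *
      exact this
    · have := h.dense (x - c)
      ring_nf at *
      exact this
    · have := h.left (x - c)
      ring_nf at *
      exact this
    · have := h.right (x - c)
      ring_nf at *
      exact this
  · refine ⟨?_, ?_, ?_, ?_, ?_⟩ <;> intro x <;> simp only [mem_map_stateIsometry_neg_one]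
    · exact h.disj _
    · have := h.indep (c - 1 - x - 1)
      ring_nf at *
      tauto
    · have := h.dense (c - 1 - x)
      ring_nf at *
      tauto
    · have := h.left (c - 1 - x - 3)
      ring_nf at *
      tauto
    · have := h.right (c - 1 - x - 3)
      ring_nf at *
      tauto

variable [NeZero N]

/-- Take for `E` the even residues and view the empty column as `E \ E`. `raggedCount_sdiff` then
expands the plain cylinder into states, in all of which consecutive elements are at distance 2. -/
theorem raggedCount_empty [Fact (1 < N)] (h2 : 2 ∣ N) :
    ∃ E : Finset (ZMod N), (∀ R, R ⊆ E → IsState R (E \ R)) ∧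
      ∀ m, raggedCount (N := N) ∅ ∅ m =
        ∑ R ∈ E.powerset, (-1) ^ R.card * stateCount R (E \ R) m := by
  classical
  let φ := ZMod.castHom h2 (ZMod 2)
  let E : Finset (ZMod N) := Finset.univ.filter fun x => φ x = 0
  have hE : ∀ x, x ∈ E ↔ φ x = 0 := by simp [E]
  have h1 : ∀ x, x + 1 ∈ E ↔ x ∉ E := by
    intro x
    rw [hE, hE, map_add, map_one]
    generalize φ x = y
    revert y
    decide
  refine ⟨E, fun R hR => ?_, fun m => ?_⟩
  · have h3 : ∀ x, x ∈ E → x + 3 ∉ E := by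
      intro x
      rw [hE, hE, map_add, map_ofNat]
      generalize φ x = y
      revert y
      decide
    have key : ∀ x, (x ∈ R ∨ x ∈ E \ R) ↔ x ∈ E := by
      intro x
      have := @hR x
      rw [Finset.mem_sdiff]
      tauto
    refine ⟨fun x hx => ?_, fun x hx => ?_, fun x => ?_, fun x hx hx' => ?_, fun x hx hx' => ?_⟩
    · rw [Finset.mem_sdiff]
      tauto
    · have := key (x + 1)
      have := key x
      have := h1 x
      tauto
    · simp only [key]
      have := h1 x
      tauto
    · exact h3 x (hR hx) (hR hx')
    · exact h3 x (Finset.mem_sdiff.1 hx).1 (Finset.mem_sdiff.1 hx').1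
  · have h := raggedCount_sdiff (C := E) (W := E) (A := ∅) m subset_rfl (by simp) (by
      intro x hx
      have h3 := h1 x
      have h4 := h1 (x - 1)
      rw [sub_add_cancel] at h4
      simp
      tauto)
    rw [Finset.sdiff_self] at h
    rw [h]
    refine Finset.sum_congr rfl fun R hR => ?_
    rw [stateCount, Finset.empty_union, Finset.union_sdiff_of_subset (Finset.mem_powerset.1 hR)]

/-- The recursion for the states without stones. -/
theorem stateCount_add_two_of_runStarts_eq_empty [Fact (1 < N)] (h : IsState A B)
    (hA : runStarts A = ∅) (m : ℕ) :
    stateCount A B (m + 2) = (-1) ^ (N / 2) * stateCount A B m := by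
  classical
  have hB : runStarts B = ∅ := by
    rw [← Finset.card_eq_zero, h.card_runStarts_eq, hA, Finset.card_empty]
  -- Without run starts both sets are invariant under translation by 2. Then nothing is exchangeable
  -- and the successor is a translate by 1, so two steps translate the whole state by 1.
  have step : ∀ {A B : Finset (ZMod N)}, IsState A B → runStarts A = ∅ → runStarts B = ∅ →
      successor A B = A.map (stateIsometry 1 1).toEmbedding ∧ ∀ m,
      stateCount A B (m + 1) = (-1) ^ A.card * stateCount B (successor A B) m := by
    intro A B h hA hB
    have pA : ∀ x, x ∈ A → x - 2 ∈ A := fun x hx => by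
      by_contra h'
      simpa [hA] using mem_runStarts.2 ⟨hx, h'⟩
    have pB : ∀ x, x ∈ B → x - 2 ∈ B := fun x hx => by
      by_contra h'
      simpa [hB] using mem_runStarts.2 ⟨hx, h'⟩
    have eA : runEnds A = ∅ := by rw [← Finset.card_eq_zero, card_runEnds, hA, Finset.card_empty]
    have qA : ∀ x, x ∈ A → x + 2 ∈ A := fun x hx => by
      by_contra h'
      simpa [eA] using mem_runEnds.2 ⟨hx, h'⟩
    constructor
    · ext x
      rw [mem_map_stateIsometry_one, mem_successor]
      have h1 := pA x
      have h2 := pA (x + 1)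
      have h3 := qA (x - 1)
      have h4 := h.facts x
      have h5 := h.facts (x - 1)
      have h6 := h.facts (x - 2)
      have h7 := h.facts (x + 1)
      have h8 := pB (x + 1)
      ring_nf at *
      grind
    · intro m
      have hE : exchangeable A B = ∅ := by
        ext x
        simp only [mem_exchangeable, Finset.notMem_empty, iff_false]
        exact fun hx => h.disj _ (pA x hx.1) hx.2.1
      rw [stateCount_succ h, hE]
      simp
  have s1 := step h hA hB
  have hs : runStarts (successor A B) = ∅ := by
    rw [← Finset.card_eq_zero, h.next.card_runStarts_eq, hB, Finset.card_empty]
  have s2 := step h.next hB hs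
  rw [s1.2, s2.2, s2.1, s1.1, stateCount_map, ← mul_assoc, ← pow_add]
  congr 2
  -- This gives `|A| + |B| = N / 2`, the exponent of the accumulated sign.
  have e : (A ∪ B)ᶜ = (A ∪ B).map (stateIsometry 1 1).toEmbedding := by
    rw [Finset.map_union, ← s1.1]
    ext x
    rw [Finset.mem_compl, Finset.mem_union, Finset.mem_union, mem_successor,
      mem_map_stateIsometry_one]
    have h1 := h.facts x
    have h2 := h.facts (x - 1)
    have h3 : x ∈ A → x - 2 ∈ A := fun hx => by
      by_contra h'
      simpa [hA] using mem_runStarts.2 ⟨hx, h'⟩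
    have h4 : x + 1 ∈ B → x + 1 - 2 ∈ B := fun hx => by
      by_contra h'
      simpa [hB] using mem_runStarts.2 ⟨hx, h'⟩
    have h5 := h.facts (x - 2)
    ring_nf at *
    grind
  have hc := congrArg Finset.card e
  rw [Finset.card_map, Finset.card_compl, ZMod.card,
    Finset.card_union_of_disjoint (Finset.disjoint_left.2 h.disj)] at hc
  omega

end LadderStates

/-! ### From states to necklaces. -/

section Stones

open Necklace

variable {N : ℕ} {A B : Finset (ZMod N)}

open Classical in
/-- The stones at the two ends of the runs of step `2` in the first column of a state. -/
noncomputable def stones (A B : Finset (ZMod N)) : Config N :=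
  (runStarts A).image (fun x => (x, if x - 2 ∈ B then -1 else -2)) ∪
    (runEnds A).image (fun x => (x + 1, if x + 2 ∈ B then 1 else 2))

open Classical in
theorem mem_stones {p : ZMod N} {v : ℤ} : (p, v) ∈ stones A B ↔
    (p ∈ A ∧ p - 2 ∉ A ∧ v = if p - 2 ∈ B then -1 else -2) ∨
      (p - 1 ∈ A ∧ p + 1 ∉ A ∧ v = if p + 1 ∈ B then 1 else 2) := by
  simp only [stones, Finset.mem_union, Finset.mem_image, mem_runStarts, mem_runEnds, Prod.mk.injEq]
  refine or_congr ⟨?_, ?_⟩ ⟨?_, ?_⟩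
  · rintro ⟨x, hx, rfl, rfl⟩
    simp [hx]
  · rintro ⟨h1, h2, rfl⟩
    exact ⟨p, ⟨h1, h2⟩, rfl, rfl⟩
  · rintro ⟨x, hx, rfl, rfl⟩
    have : x + 1 + 1 = x + 2 := by ring
    simp [hx, this]
  · rintro ⟨h1, h2, rfl⟩
    have : p - 1 + 2 = p + 1 := by ring
    exact ⟨p - 1, by rw [this]; exact ⟨h1, h2⟩, by ring, by rw [this]⟩

theorem exists_mem_stones {p : ZMod N} : (∃ v, (p, v) ∈ stones A B) ↔
    (p ∈ A ∧ p - 2 ∉ A) ∨ (p - 1 ∈ A ∧ p + 1 ∉ A) := by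
  simp only [mem_stones]
  constructor
  · rintro ⟨v, h | h⟩
    · exact Or.inl ⟨h.1, h.2.1⟩
    · exact Or.inr ⟨h.1, h.2.1⟩
  · rintro (h | h)
    · exact ⟨_, Or.inl ⟨h.1, h.2, rfl⟩⟩
    · exact ⟨_, Or.inr ⟨h.1, h.2, rfl⟩⟩

theorem neg_of_mem_stones {p : ZMod N} {v : ℤ} (h : (p, v) ∈ stones A B) (hv : v < 0) :
    p ∈ A ∧ p - 2 ∉ A ∧ (p - 2 ∈ B ∧ v = -1 ∨ p - 2 ∉ B ∧ v = -2) := by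
  classical
  rcases mem_stones.1 h with ⟨h1, h2, h3⟩ | ⟨h1, h2, h3⟩
  · refine ⟨h1, h2, ?_⟩
    split_ifs at h3 <;> tauto
  · split_ifs at h3 <;> omega

theorem pos_of_mem_stones {p : ZMod N} {v : ℤ} (h : (p, v) ∈ stones A B) (hv : 0 < v) :
    p - 1 ∈ A ∧ p + 1 ∉ A ∧ (p + 1 ∈ B ∧ v = 1 ∨ p + 1 ∉ B ∧ v = 2) := by
  classical
  rcases mem_stones.1 h with ⟨h1, h2, h3⟩ | ⟨h1, h2, h3⟩
  · split_ifs at h3 <;> omega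
  · refine ⟨h1, h2, ?_⟩
    split_ifs at h3 <;> tauto

theorem vector_of_mem_stones {p : ZMod N} {v : ℤ} (h : (p, v) ∈ stones A B) :
    v = -2 ∨ v = -1 ∨ v = 1 ∨ v = 2 := by
  classical
  rcases mem_stones.1 h with ⟨h1, h2, h3⟩ | ⟨h1, h2, h3⟩ <;> split_ifs at h3 <;> omega

theorem IsState.eq_of_mem_stones (h : IsState A B) {p : ZMod N} {v w : ℤ}
    (hv : (p, v) ∈ stones A B) (hw : (p, w) ∈ stones A B) : v = w := by
  classical
  have h1 := h.facts (p - 1)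
  rw [sub_add_cancel] at h1
  rw [mem_stones] at hv hw
  rcases hv with hv | hv <;> rcases hw with hw | hw
  · rw [hv.2.2, hw.2.2]
  · tauto
  · tauto
  · rw [hv.2.2, hw.2.2]

theorem IsState.card_stones (h : IsState A B) : (stones A B).card = 2 * (runStarts A).card := by
  classical
  rw [stones, Finset.card_union_of_disjoint, Finset.card_image_of_injective,
    Finset.card_image_of_injective, card_runEnds, two_mul]
  · exact fun x y hxy => by simpa using (Prod.mk.inj hxy).1
  · exact fun x y hxy => (Prod.mk.inj hxy).1
  · rw [Finset.disjoint_left]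
    intro s hs hs'
    obtain ⟨x, hx, rfl⟩ := Finset.mem_image.1 hs
    obtain ⟨y, hy, hxy⟩ := Finset.mem_image.1 hs'
    have e := (Prod.mk.inj hxy).1
    rw [mem_runStarts] at hx
    rw [mem_runEnds] at hy
    have := h.indep y
    rw [e] at this
    tauto

/-- A negative stone sits at the start of a run of `A`. The next stone is the one just behind the
end of this run, so the distance is `2 * j + 1`. -/
theorem IsState.of_consecutive_neg (h : IsState A B) {s t : ZMod N × ℤ} {d : ℕ}
    (hst : Consecutive (stones A B) s t d) (hs : s.2 < 0) : 0 < t.2 ∧ Odd d := by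
  obtain ⟨p, v⟩ := s
  obtain ⟨q, w⟩ := t
  obtain ⟨hs', ht, hd, rfl, hno⟩ := hst
  have hp := neg_of_mem_stones hs' hs
  have hno' : ∀ e : ℕ, 0 < e → e < d → ¬ ((p + e ∈ A ∧ p + e - 2 ∉ A) ∨
      (p + e - 1 ∈ A ∧ p + e + 1 ∉ A)) := fun e he he' h' => by
    obtain ⟨u, hu⟩ := exists_mem_stones.2 h'
    exact hno e he he' _ hu rfl
  have run : ∀ j : ℕ, 2 * j < d → p + (2 * j : ℕ) ∈ A := by
    intro j
    induction j with
    | zero => intro _; simpa using hp.1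
    | succ j ih =>
      intro hj
      have h1 := ih (by omega)
      have h2 := hno' (2 * j + 1) (by omega) (by omega)
      push_cast at *
      ring_nf at *
      tauto
  rcases Nat.even_or_odd' d with ⟨j, rfl | rfl⟩
  · exfalso
    obtain ⟨j, rfl⟩ : ∃ i, j = i + 1 := ⟨j - 1, by omega⟩
    have h1 := run j (by omega)
    have h2 := hno' (2 * j + 1) (by omega) (by omega)
    have h3 := exists_mem_stones.1 ⟨w, ht⟩
    have h4 := h.indep (p + (2 * j : ℕ))
    have h5 := h.indep (p + (2 * j + 1 : ℕ))
    dsimp only at h3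
    push_cast at *
    ring_nf at *
    tauto
  · refine ⟨?_, j, rfl⟩
    have h1 := run j (by omega)
    have h4 := h.indep (p + (2 * j : ℕ))
    by_contra hw
    have h3 := neg_of_mem_stones ht (by have := vector_of_mem_stones ht; omega)
    dsimp only at h3
    push_cast at *
    ring_nf at *
    tauto

/-- Two stones facing each other enclose one run of `B`. The two vectors measure the gaps on either
side of it, and the run itself covers an arc of odd length `2 * j + 1`. -/
theorem IsState.of_consecutive_pos (h : IsState A B) {s t : ZMod N × ℤ} {d : ℕ}
    (hst : Consecutive (stones A B) s t d) (hs : 0 < s.2) :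
    t.2 < 0 ∧ ∃ j : ℕ, d = s.2.natAbs + 2 * j + 1 + t.2.natAbs := by
  obtain ⟨p, v⟩ := s
  obtain ⟨q, w⟩ := t
  obtain ⟨hs', ht, hd, rfl, hno⟩ := hst
  dsimp only at *
  have hp := pos_of_mem_stones hs' hs
  have hno' : ∀ e : ℕ, 0 < e → e < d → ¬ ((p + e ∈ A ∧ p + e - 2 ∉ A) ∨
      (p + e - 1 ∈ A ∧ p + e + 1 ∉ A)) := fun e he he' h' => by
    obtain ⟨u, hu⟩ := exists_mem_stones.2 h'
    exact hno e he he' _ hu rfl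
  have ht' := exists_mem_stones.1 ⟨w, ht⟩
  obtain ⟨a, rfl⟩ : ∃ a : ℕ, v = a := ⟨v.natAbs, by omega⟩
  -- The jump of the stone ends at the start of the next run of `B`.
  have hq : p + (a : ZMod N) ∈ B := by
    have h1 := h.facts (p - 1)
    have h2 := h.facts p
    have h3 := h.facts (p + 1)
    rcases hp with ⟨h4, h5, ⟨h6, h7⟩ | ⟨h6, h7⟩⟩
    · obtain rfl : a = 1 := by omega
      simpa using h6
    · obtain rfl : a = 2 := by omega
      push_cast
      ring_nf at *
      grind
  have had : a + 2 ≤ d := by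
    by_contra hlt
    have h1 := h.indep (p - 1)
    have h2 := h.facts (p + a)
    have h4 := h.indep (p + a - 1)
    rw [sub_add_cancel] at h1 h4
    have h3 : d = a + 1 ∨ d = a ∨ (d = 1 ∧ a = 2) := by
      have := vector_of_mem_stones hs'
      omega
    have h5 : p + d ∈ A ∨ p + d - 1 ∈ A := ht'.imp And.left And.left
    clear ht' hno hno' ht hs'
    rcases h3 with rfl | rfl | ⟨rfl, rfl⟩
    · rw [Nat.cast_succ, ← add_assoc, add_sub_cancel_right] at h5
      exact h5.elim (h2.2.2.1 (Or.inr hq)).1 (h2.2.1 hq).1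
    · exact h5.elim (h2.2.1 hq).1 fun h6 => (h4 (Or.inl h6)).2 hq
    · rw [Nat.cast_one, add_sub_cancel_right] at h5
      exact h5.elim hp.2.1 (h1 (Or.inl hp.1)).1
  have run : ∀ j : ℕ, a + 2 * j + 2 ≤ d → p + (a + 2 * j : ℕ) ∈ B := by
    intro j
    induction j with
    | zero => intro _; simpa using hq
    | succ j ih =>
      intro hj
      have h1 := ih (by omega)
      have h2 := hno' (a + 2 * j + 2) (by omega) (by omega)
      have h3 := hno' (a + 2 * j + 3) (by omega) (by omega)
      have f0 := h.facts (p + (a + 2 * j : ℕ))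
      have f1 := h.facts (p + (a + 2 * j : ℕ) + 1)
      have f2 := h.facts (p + (a + 2 * j : ℕ) + 2)
      have f3 := h.facts (p + (a + 2 * j : ℕ) + 3)
      push_cast at *
      ring_nf at *
      grind
  obtain ⟨j, hj | hj⟩ : ∃ j, d = a + 2 * j + 2 ∨ d = a + 2 * j + 3 := by
    rcases Nat.even_or_odd' (d - a) with ⟨i, hi | hi⟩
    · exact ⟨i - 1, by omega⟩
    · exact ⟨i - 1, by omega⟩
  · subst hj
    have h1 := run j (by omega)
    have f0 := h.facts (p + (a + 2 * j : ℕ))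
    have f1 := h.facts (p + (a + 2 * j : ℕ) + 1)
    have e2 : p + ((a + 2 * j + 2 : ℕ) : ZMod N) - 2 = p + (a + 2 * j : ℕ) := by push_cast; ring
    have e1 : p + ((a + 2 * j + 2 : ℕ) : ZMod N) - 1 = p + (a + 2 * j : ℕ) + 1 := by
      push_cast; ring
    rcases vector_of_mem_stones ht with hw | hw | hw | hw
    · have h5 := neg_of_mem_stones ht (by omega)
      rw [e2] at h5
      exact absurd h1 (h5.2.2.resolve_left (by omega)).1
    · exact ⟨by omega, j, by omega⟩
    all_goals
      have h5 := pos_of_mem_stones ht (by omega)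
      rw [e1] at h5
      exact absurd h5.1 (f0.2.2.1 (Or.inr h1)).1
  · subst hj
    have h1 := run j (by omega)
    have h2 := hno' (a + 2 * j + 2) (by omega) (by omega)
    have f0 := h.facts (p + (a + 2 * j : ℕ))
    have f1 := h.facts (p + (a + 2 * j : ℕ) + 1)
    have e2 : p + ((a + 2 * j + 3 : ℕ) : ZMod N) - 2 = p + (a + 2 * j : ℕ) + 1 := by
      push_cast; ring
    have e1 : p + ((a + 2 * j + 3 : ℕ) : ZMod N) - 1 = p + (a + 2 * j + 2 : ℕ) := by
      push_cast; ring
    have e3 : p + ((a + 2 * j + 2 : ℕ) : ZMod N) - 2 = p + (a + 2 * j : ℕ) := by push_cast; ring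
    rw [e3] at h2
    rcases vector_of_mem_stones ht with hw | hw | hw | hw
    · exact ⟨by omega, j, by omega⟩
    · have h5 := neg_of_mem_stones ht (by omega)
      rw [e2] at h5
      exact absurd (h5.2.2.resolve_right (by omega)).1 (f0.2.2.1 (Or.inr h1)).2
    all_goals
      have h5 := pos_of_mem_stones ht (by omega)
      rw [e1] at h5
      exact absurd (Or.inl ⟨h5.1, (f0.2.1 h1).1⟩) h2

theorem IsState.isNecklace_stones (h : IsState A B) :
    IsNecklace (runStarts A).card N (stones A B) where
  card_eq := h.card_stones
  distinct s hs t ht hst := by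
    obtain ⟨p, v⟩ := s
    obtain ⟨q, w⟩ := t
    obtain rfl : p = q := hst
    rw [h.eq_of_mem_stones hs ht]
  vector_mem s hs := vector_of_mem_stones hs
  opposite s t d hst := by
    rcases lt_or_ge s.2 0 with hs | hs
    · exact Or.inr ⟨hst, hs, (h.of_consecutive_neg hst hs).1⟩
    · have hs' : 0 < s.2 := by
        have := vector_of_mem_stones (p := s.1) (v := s.2) hst.1
        omega
      exact Or.inl ⟨hst, hs', (h.of_consecutive_pos hst hs').1⟩
  away_odd s t d hst := (h.of_consecutive_neg hst.1 hst.2.1).2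
  towards_odd s t d hst := by
    obtain ⟨h1, j, hj⟩ := h.of_consecutive_pos hst.1 hst.2.1
    exact ⟨s.2.natAbs + j + t.2.natAbs, by omega⟩
  towards_ge s t d hst := by
    obtain ⟨h1, j, hj⟩ := h.of_consecutive_pos hst.1 hst.2.1
    have := hst.2.1
    omega
  towards_three s t hst := by
    obtain ⟨h1, j, hj⟩ := h.of_consecutive_pos hst.1 hst.2.1
    have := hst.2.1
    omega

end Stones

/-! ### The successor map is the necklace transformation. -/

section Stones

open Necklace

variable {N : ℕ} {A B : Finset (ZMod N)}

open Classical in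
-- Jumping crosses the gap between a run of `A` and the neighbouring run of `B`, so the stones land
-- on the ends of the runs of `B`. The turned vector has length 2 exactly when the crossed gap was
-- the short one.
theorem IsState.mem_jumpTurn_stones (h : IsState A B) {y : ZMod N} {w : ℤ} :
    (y, w) ∈ jumpTurn (stones A B) ↔
      (y - 1 ∈ B ∧ y + 1 ∉ B ∧ w = if y + 1 ∈ A then 2 else 1) ∨
      (y ∈ B ∧ y - 2 ∉ B ∧ w = if y - 2 ∈ A then -2 else -1) := by
  simp only [jumpTurn, Finset.mem_image, Prod.exists, Prod.mk.injEq]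
  constructor
  · rintro ⟨p, v, hp, rfl, rfl⟩
    rcases mem_stones.1 hp with ⟨h1, h2, rfl⟩ | ⟨h1, h2, rfl⟩
    · have f0 := h.facts p
      have f1 := h.facts (p - 1)
      have f2 := h.facts (p - 2)
      have f3 := h.facts (p - 3)
      left
      by_cases h3 : p - 2 ∈ B
      · have e : p + ((-1 : ℤ) : ZMod N) = p - 1 := by push_cast; ring
        rw [if_pos h3, e, if_pos (by simpa using h1), show turn (-1) = 2 from rfl]
        ring_nf at *
        grind
      · have e : p + ((-2 : ℤ) : ZMod N) = p - 2 := by push_cast; ring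
        rw [if_neg h3, e, if_neg, show turn (-2) = 1 from rfl]
        all_goals
          ring_nf at *
          grind
    · have f0 := h.facts (p - 1)
      have f1 := h.facts p
      have f2 := h.facts (p + 1)
      right
      by_cases h3 : p + 1 ∈ B
      · have e : p + ((1 : ℤ) : ZMod N) = p + 1 := by push_cast; ring
        have e' : p + 1 - 2 = p - 1 := by ring
        rw [if_pos h3, e, if_pos (by rwa [e']), show turn 1 = -2 from rfl]
        ring_nf at *
        grind
      · have e : p + ((2 : ℤ) : ZMod N) = p + 2 := by push_cast; ring
        rw [if_neg h3, e, if_neg, show turn 2 = -1 from rfl]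
        all_goals
          ring_nf at *
          grind
  · rintro (⟨h1, h2, rfl⟩ | ⟨h1, h2, rfl⟩)
    · by_cases h3 : y + 1 ∈ A
      · refine ⟨y + 1, -1, mem_stones.2 (Or.inl ?_), by push_cast; ring, by simp [turn, h3]⟩
        have f0 := h.facts (y - 1)
        ring_nf at *
        grind
      · refine ⟨y + 2, -2, mem_stones.2 (Or.inl ?_), by push_cast; ring, by simp [turn, h3]⟩
        have f0 := h.facts (y - 1)
        have f1 := h.facts y
        have f2 := h.facts (y + 1)
        ring_nf at *
        grind
    · by_cases h3 : y - 2 ∈ A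
      · refine ⟨y - 1, 1, mem_stones.2 (Or.inr ?_), by push_cast; ring, by simp [turn, h3]⟩
        have f0 := h.facts y
        ring_nf at *
        grind
      · refine ⟨y - 2, 2, mem_stones.2 (Or.inr ?_), by push_cast; ring, by simp [turn, h3]⟩
        have f0 := h.facts y
        have f1 := h.facts (y - 1)
        have f2 := h.facts (y - 2)
        have f3 := h.facts (y - 3)
        ring_nf at *
        grind

/-- This is the configuration around the exchangeable vertex `y - 2`. -/
theorem IsState.faceTowards_three (h : IsState A B) {y : ZMod N} (h1 : y ∈ B)
    (h2 : y - 2 ∈ A) (h3 : y - 4 ∈ B) :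
    FaceTowards (jumpTurn (stones A B)) (y - 3, 2) (y, -2) 3 := by
  classical
  have f0 := h.facts y
  have f1 := h.facts (y - 1)
  have f2 := h.facts (y - 2)
  have f3 := h.facts (y - 3)
  have f4 := h.facts (y - 4)
  refine ⟨⟨?_, ?_, by norm_num, by simp, ?_⟩, by norm_num, by norm_num⟩
  · rw [h.mem_jumpTurn_stones]
    left
    ring_nf at *
    grind
  · rw [h.mem_jumpTurn_stones]
    right
    ring_nf at *
    grind
  · rintro e he he' ⟨u, w⟩ hu rfl
    rw [h.mem_jumpTurn_stones] at hu
    obtain rfl | rfl : e = 1 ∨ e = 2 := by omega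
    · push_cast at *
      ring_nf at *
      grind
    · push_cast at *
      ring_nf at *
      grind

variable [NeZero N]

/-- After the turn the positions are already right. A vector of length 1 is right because the place
beyond the gap is free. A vector of length 2 points at an element of `A`, which belongs to the
successor exactly when it is exchangeable, and that means two stones facing each other at distance
3: the case repaired by `fix`. -/
theorem IsState.transform_stones (h : IsState A B) :
    transform (stones A B) = stones B (successor A B) := by
  classical
  have hf : ∀ s ∈ jumpTurn (stones A B), ∀ v : ℤ,
      (s.1, v) ∈ stones B (successor A B) ↔
      v = if (∃ t, FaceTowards (jumpTurn (stones A B)) s t 3) ∨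
        (∃ t, FaceTowards (jumpTurn (stones A B)) t s 3) then s.2.sign else s.2 := by
    rintro ⟨y, w⟩ hs v
    have hs' := h.mem_jumpTurn_stones.1 hs
    dsimp only
    rcases hs' with ⟨h1, h2, h3⟩ | ⟨h1, h2, h3⟩
    · have e : (y, v) ∈ stones B (successor A B) ↔
          v = if y + 1 ∈ successor A B then 1 else 2 := by
        rw [mem_stones]
        have f1 := h.indep (y - 1)
        rw [sub_add_cancel] at f1
        tauto
      rw [e]
      by_cases hA : y + 1 ∈ A
      · rw [if_pos hA] at h3
        by_cases h4 : y + 3 ∈ B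
        · have hx := h.faceTowards_three (y := y + 3) h4 (by convert hA using 1; ring)
            (by convert h1 using 1; ring)
          rw [add_sub_cancel_right] at hx
          rw [h3, if_pos (Or.inl ⟨_, hx⟩), if_pos]
          · rfl
          · rw [mem_successor]
            ring_nf at *
            tauto
        · rw [h3, if_neg, if_neg]
          rotate_left
          · rw [mem_successor]
            ring_nf at *
            tauto
          · rintro (⟨⟨q, u⟩, hu, -, hu'⟩ | ⟨t, -, -, h'⟩)
            · have hq := (h.mem_jumpTurn_stones (y := q) (w := u)).1 hu.2.1
              obtain rfl : q = y + 3 := by simpa using hu.2.2.2.1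
              rcases hq with hq | hq
              · have := hq.2.2
                split_ifs at this <;> omega
              · exact h4 hq.1
            · omega
      · rw [if_neg hA] at h3
        have : y + 1 ∈ successor A B := by
          have f1 := h.facts (y - 1)
          rw [mem_successor]
          ring_nf at *
          grind
        rw [h3, if_pos this]
        simp
    · have e : (y, v) ∈ stones B (successor A B) ↔
          v = if y - 2 ∈ successor A B then -1 else -2 := by
        rw [mem_stones]
        have f1 := h.indep (y - 1)
        rw [sub_add_cancel] at f1
        tauto
      rw [e]
      by_cases hA : y - 2 ∈ A
      · rw [if_pos hA] at h3
        by_cases h4 : y - 4 ∈ B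
        · have hx := h.faceTowards_three h1 hA h4
          rw [h3, if_pos (Or.inr ⟨_, hx⟩), if_pos]
          · rfl
          · rw [mem_successor]
            ring_nf at *
            tauto
        · rw [h3, if_neg, if_neg]
          rotate_left
          · rw [mem_successor]
            ring_nf at *
            tauto
          · rintro (⟨t, -, h', -⟩ | ⟨⟨q, u⟩, hu, hu', -⟩)
            · omega
            · have hq := (h.mem_jumpTurn_stones (y := q) (w := u)).1 hu.1
              have hqy : y = q + 3 := by simpa using hu.2.2.2.1
              rcases hq with hq | hq
              · refine h4 ?_
                rw [hqy]
                convert hq.1 using 1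
                ring
              · have := hq.2.2
                dsimp only at hu'
                split_ifs at this <;> omega
      · rw [if_neg hA] at h3
        have : y - 2 ∈ successor A B := by
          have f1 := h.facts y
          have f2 := h.facts (y - 1)
          have f3 := h.facts (y - 3)
          rw [mem_successor]
          ring_nf at *
          grind
        rw [h3, if_pos this]
        simp
  ext ⟨y, v⟩
  rw [transform, fix, Finset.mem_image]
  constructor
  · rintro ⟨s, hs, h'⟩
    have h1 := hf s hs v
    have h2 : s.1 = y := by
      have := congrArg Prod.fst h'
      dsimp only at this
      split_ifs at this <;> exact this
    rw [h2] at h1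
    rw [h1]
    have := congrArg Prod.snd h'
    dsimp only at this
    rw [← this]
    split_ifs <;> rfl
  · intro hv
    have hp := exists_mem_stones.1 ⟨v, hv⟩
    obtain ⟨w, hw⟩ : ∃ w, (y, w) ∈ jumpTurn (stones A B) := by
      simp only [h.mem_jumpTurn_stones]
      rcases hp with hp | hp
      · exact ⟨_, Or.inr ⟨hp.1, hp.2, rfl⟩⟩
      · exact ⟨_, Or.inl ⟨hp.1, hp.2, rfl⟩⟩
    refine ⟨(y, w), hw, ?_⟩
    have := (hf _ hw v).1 hv
    dsimp only at this
    rw [this]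
    split_ifs <;> rfl

end Stones

/-! ### A state with stones is determined by its necklace. -/

section Stones

open Necklace

variable {N : ℕ} {A B A' B' : Finset (ZMod N)}

theorem stones_map (ε : ℤˣ) (c : ZMod N) :
    stones (A.map (stateIsometry ε c).toEmbedding) (B.map (stateIsometry ε c).toEmbedding) =
      (stones A B).image (moveStone ε c) := by
  classical
  ext ⟨p, v⟩
  rcases Int.units_eq_one_or ε with rfl | rfl
  · have e : (p, v) ∈ (stones A B).image (moveStone 1 c) ↔ (p - c, v) ∈ stones A B := by
      simp only [Finset.mem_image, moveStone, Prod.exists, Prod.mk.injEq, Units.val_one,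
        Int.cast_one, one_mul]
      constructor
      · rintro ⟨q, w, h, rfl, rfl⟩
        simpa using h
      · exact fun h => ⟨_, _, h, by ring, rfl⟩
    rw [e, mem_stones, mem_stones]
    simp only [mem_map_stateIsometry_one]
    ring_nf
  · have e : (p, v) ∈ (stones A B).image (moveStone (-1) c) ↔ (c - p, -v) ∈ stones A B := by
      simp only [Finset.mem_image, moveStone, Prod.exists, Prod.mk.injEq, Units.val_neg,
        Units.val_one, Int.cast_neg, Int.cast_one]
      constructor
      · rintro ⟨q, w, h, rfl, rfl⟩
        convert h using 2 <;> ring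
      · exact fun h => ⟨_, _, h, by ring, by ring⟩
    have h1 : c - 1 - p = c - p - 1 := by ring
    have h2 : c - 1 - (p - 2) = c - p + 1 := by ring
    have h3 : c - 1 - (p - 1) = c - p := by ring
    have h4 : c - 1 - (p + 1) = c - p - 2 := by ring
    rw [e, mem_stones, mem_stones]
    simp only [mem_map_stateIsometry_neg_one, h1, h2, h3, h4]
    constructor
    · rintro (⟨h1, h2, rfl⟩ | ⟨h1, h2, rfl⟩)
      · exact Or.inr ⟨h1, h2, by split_ifs <;> rfl⟩
      · exact Or.inl ⟨h1, h2, by split_ifs <;> rfl⟩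
    · rintro (⟨h1, h2, h3⟩ | ⟨h1, h2, h3⟩)
      · exact Or.inr ⟨h1, h2, by rw [← neg_neg v, h3]; split_ifs <;> rfl⟩
      · exact Or.inl ⟨h1, h2, by rw [← neg_neg v, h3]; split_ifs <;> rfl⟩

/-- Every element is reached from a run start. Otherwise, walking back in steps of 2 would never
leave `A`, and would meet either `y - 2` or `y - 1` for a run start `y`; the first is not in `A`,
the second is adjacent to `y`. -/
theorem IsState.mem_induction [NeZero N] (h : IsState A B) (hne : (runStarts A).Nonempty)
    {P : ZMod N → Prop} (hstart : ∀ x ∈ A, x - 2 ∉ A → P x)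
    (hstep : ∀ x ∈ A, x + 2 ∈ A → P x → P (x + 2)) : ∀ x ∈ A, P x := by
  intro x hx
  by_contra hP
  have back : ∀ i : ℕ, x - (2 * i : ℕ) ∈ A ∧ ¬ P (x - (2 * i : ℕ)) := by
    intro i
    induction i with
    | zero => simpa using ⟨hx, hP⟩
    | succ i ih =>
      have e : x - ((2 * (i + 1) : ℕ) : ZMod N) = x - (2 * i : ℕ) - 2 := by push_cast; ring
      rw [e]
      have h1 : x - ((2 * i : ℕ) : ZMod N) - 2 ∈ A := by
        by_contra h'
        exact ih.2 (hstart _ ih.1 h')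
      refine ⟨h1, fun h' => ih.2 ?_⟩
      have := hstep _ h1 (by rw [sub_add_cancel]; exact ih.1) h'
      rwa [sub_add_cancel] at this
  obtain ⟨y, hy⟩ := hne
  rw [mem_runStarts] at hy
  obtain ⟨n, hn⟩ : ∃ n : ℕ, (n : ZMod N) = x - (y - 2) := ⟨_, ZMod.natCast_zmod_val _⟩
  rcases Nat.even_or_odd' n with ⟨i, rfl | rfl⟩
  · have := (back i).1
    rw [hn] at this
    exact hy.2 (by simpa using this)
  · have h1 := (back i).1
    have e : x - ((2 * i : ℕ) : ZMod N) = y - 1 := by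
      rw [Nat.cast_succ] at hn
      linear_combination -hn
    rw [e] at h1
    have := h.indep _ (Or.inl h1)
    rw [sub_add_cancel] at this
    exact this.1 hy.1

theorem IsState.subset_of_stones_eq [NeZero N] (h : IsState A B) (h' : IsState A' B')
    (hne : (runStarts A).Nonempty) (hst : stones A B = stones A' B') : A ⊆ A' ∧ B ⊆ B' := by
  classical
  have hneg : ∀ p v, v < 0 → (p, v) ∈ stones A B → p ∈ A' ∧ p - 2 ∉ A' ∧ (v = -1 → p - 2 ∈ B') :=
    fun p v hv hp => by
      rw [hst] at hp
      have := neg_of_mem_stones hp hv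
      refine ⟨this.1, this.2.1, fun h1 => ?_⟩
      rcases this.2.2 with h2 | h2
      · exact h2.1
      · omega
  have hneg' : ∀ p, p ∈ A' → p - 2 ∉ A' → p ∈ A ∧ p - 2 ∉ A := fun p h1 h2 => by
    have h3 : (p, if p - 2 ∈ B' then -1 else -2) ∈ stones A B := by
      rw [hst]
      exact mem_stones.2 (Or.inl ⟨h1, h2, rfl⟩)
    have := neg_of_mem_stones h3 (by split_ifs <;> norm_num)
    exact ⟨this.1, this.2.1⟩
  have hpos' : ∀ p, p - 1 ∈ A' → p + 1 ∉ A' → p - 1 ∈ A ∧ p + 1 ∉ A := fun p h1 h2 => by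
    have h3 : (p, if p + 1 ∈ B' then 1 else 2) ∈ stones A B := by
      rw [hst]
      exact mem_stones.2 (Or.inr ⟨h1, h2, rfl⟩)
    have := pos_of_mem_stones h3 (by split_ifs <;> norm_num)
    exact ⟨this.1, this.2.1⟩
  constructor
  · refine h.mem_induction hne (fun x hx hx' => ?_) fun x hx hx' hP => ?_
    · exact (hneg x _ (by split_ifs <;> norm_num) (mem_stones.2 (Or.inl ⟨hx, hx', rfl⟩))).1
    · by_contra h2
      have e : x + 1 + 1 = x + 2 := by ring
      have := hpos' (x + 1) (by simpa using hP) (by rwa [e])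
      rw [e] at this
      exact this.2 hx'
  · have hneB : (runStarts B).Nonempty := by
      rw [← Finset.card_pos, h.card_runStarts_eq, Finset.card_pos]
      exact hne
    refine h.symm.mem_induction hneB (fun y hy hy' => ?_) fun z hz hz' hP => ?_
    · have f0 := h.facts y
      have f1 := h.facts (y - 1)
      have f2 := h.facts (y - 2)
      have f3 := h.facts (y - 3)
      -- The run of `A` before the start `y` of a run of `B` ends at `y - 2` or `y - 3`. The vector
      -- of the stone there, 1 or 2, also locates the run start of `B'`.
      by_cases h2 : y - 2 ∈ A
      · have hs : (y - 1, 1) ∈ stones A B := by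
          rw [mem_stones]
          right
          ring_nf at *
          grind
        rw [hst] at hs
        rcases (pos_of_mem_stones hs one_pos).2.2 with h4 | h4
        · simpa using h4.1
        · omega
      · have hs : (y - 2, 2) ∈ stones A B := by
          rw [mem_stones]
          right
          ring_nf at *
          grind
        rw [hst] at hs
        have h4 := pos_of_mem_stones hs two_pos
        have g0 := h'.facts (y - 1)
        have g1 := h'.facts (y - 2)
        have g2 := h'.facts (y - 3)
        ring_nf at *
        grind
    -- If `z + 2 ∉ B'`, then after `z` a run of `A'` starts at `z + 2` or `z + 3`. Its stone is
    -- shared with `A`, which contradicts `z + 2 ∈ B`.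
    · have f0 := h.facts (z + 2)
      have g0 := h'.facts z
      have g1 := h'.facts (z + 1)
      have g2 := h'.facts (z + 2)
      have a := hneg' (z + 2)
      have b := hneg' (z + 3)
      ring_nf at *
      grind

theorem IsState.eq_of_stones_eq [NeZero N] (h : IsState A B) (h' : IsState A' B')
    (hne : (runStarts A).Nonempty) (hst : stones A B = stones A' B') : A = A' ∧ B = B' := by
  have hne' : (runStarts A').Nonempty := by
    have h1 := h.card_stones
    have h2 := h'.card_stones
    rw [hst] at h1
    rw [← Finset.card_pos] at *
    omega
  have h1 := h.subset_of_stones_eq h' hne hst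
  have h2 := h'.subset_of_stones_eq h hne' hst.symm
  exact ⟨h1.1.antisymm h2.1, h1.2.antisymm h2.2⟩

theorem IsState.stateCount_eq_of_stones_eq [NeZero N] [Fact (1 < N)] (h : IsState A B)
    (h' : IsState A' B') (hne : (runStarts A').Nonempty) {ε : ℤˣ} {c : ZMod N}
    (hst : stones A' B' = (stones A B).image (moveStone ε c)) :
    stateCount A' B' = stateCount A B := by
  rw [← stones_map] at hst
  obtain ⟨rfl, rfl⟩ := h'.eq_of_stones_eq (h.map ε c) hne hst
  exact funext fun m => stateCount_map ε c m

end Stones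

/-! ### Directed cycles in walks. -/

section PeriodicWalk

open Necklace

/-- A walk that returns to a vertex contains a directed cycle. -/
theorem exists_hasCycleOfLength {V : Type*} {G : Digraph V} {a : ℕ → V}
    (ha : ∀ i, G.Adj (a i) (a (i + 1))) {i j : ℕ} (hij : i < j) (h : a i = a j) :
    ∃ l, HasCycleOfLength G l ∧ ∃ i, a i = a (i + l) := by
  classical
  -- The shortest return time over all starting points makes the closed walk injective.
  have hex : ∃ l, 0 < l ∧ ∃ i, a i = a (i + l) :=
    ⟨j - i, by omega, i, by rw [h]; congr 1; omega⟩
  obtain ⟨hl, i₀, hi₀⟩ := Nat.find_spec hex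
  have hmin : ∀ l', 0 < l' → l' < Nat.find hex → ∀ i, a i ≠ a (i + l') :=
    fun l' h1 h2 i h3 => Nat.find_min hex h2 ⟨h1, i, h3⟩
  generalize Nat.find hex = l at *
  have : NeZero l := ⟨hl.ne'⟩
  refine ⟨l, ⟨hl, fun z => a (i₀ + z.val), fun z w hzw => ?_, fun z => ?_⟩, i₀, hi₀⟩
  · have key : ∀ z w : ZMod l, z.val < w.val → a (i₀ + z.val) ≠ a (i₀ + w.val) := by
      intro z w hlt
      have h1 := hmin (w.val - z.val) (by omega) (by have := ZMod.val_lt w; omega) (i₀ + z.val)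
      rwa [show i₀ + z.val + (w.val - z.val) = i₀ + w.val by omega] at h1
    rcases lt_trichotomy z.val w.val with h1 | h1 | h1
    · exact absurd hzw (key z w h1)
    · exact ZMod.val_injective l h1
    · exact absurd hzw.symm (key w z h1)
  · have h1 := ha (i₀ + z.val)
    have h4 : z + 1 = ((z.val + 1 : ℕ) : ZMod l) := by rw [Nat.cast_succ, ZMod.natCast_zmod_val]
    change G.Adj (a (i₀ + z.val)) (a (i₀ + (z + 1).val))
    by_cases hz : z.val + 1 < l
    · rwa [h4, ZMod.val_natCast_of_lt hz]
    · have h2 : z.val + 1 = l := by have := ZMod.val_lt z; omega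
      rw [h4, h2, ZMod.natCast_self, ZMod.val_zero, add_zero, hi₀]
      rwa [add_assoc, h2] at h1

end PeriodicWalk

/-! ### Power series with a prescribed denominator. -/

section Denominators

open Polynomial

/-- `D` is a denominator of the power series `f`. -/
def HasDenominator (D : ℤ[X]) (f : PowerSeries ℤ) : Prop :=
  ∃ h : ℤ[X], f * (D : PowerSeries ℤ) = (h : PowerSeries ℤ)

variable {D E : ℤ[X]} {f g : PowerSeries ℤ}

theorem HasDenominator.add (hf : HasDenominator D f) (hg : HasDenominator D g) :
    HasDenominator D (f + g) := by
  obtain ⟨p, hp⟩ := hf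
  obtain ⟨q, hq⟩ := hg
  exact ⟨p + q, by rw [add_mul, hp, hq, Polynomial.coe_add]⟩

theorem HasDenominator.coe_mul (hf : HasDenominator D f) (p : ℤ[X]) :
    HasDenominator D ((p : PowerSeries ℤ) * f) := by
  obtain ⟨q, hq⟩ := hf
  exact ⟨p * q, by rw [mul_assoc, hq, Polynomial.coe_mul]⟩

theorem hasDenominator_coe (p : ℤ[X]) : HasDenominator D (p : PowerSeries ℤ) :=
  ⟨p * D, (Polynomial.coe_mul _ _).symm⟩

theorem hasDenominator_sum {ι : Type*} {s : Finset ι} {F : ι → PowerSeries ℤ}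
    (h : ∀ i ∈ s, HasDenominator D (F i)) : HasDenominator D (∑ i ∈ s, F i) :=
  Finset.sum_induction F (HasDenominator D) (fun _ _ => HasDenominator.add)
    (by simpa using hasDenominator_coe (D := D) 0) h

theorem HasDenominator.of_dvd (hf : HasDenominator D f) (h : D ∣ E) : HasDenominator E f := by
  obtain ⟨q, rfl⟩ := h
  obtain ⟨p, hp⟩ := hf
  exact ⟨p * q, by rw [Polynomial.coe_mul, ← mul_assoc, hp, Polynomial.coe_mul]⟩

theorem HasDenominator.of_coe_mul (h : HasDenominator D ((E : PowerSeries ℤ) * f)) :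
    HasDenominator (D * E) f := by
  obtain ⟨p, hp⟩ := h
  exact ⟨p, by rw [← hp, Polynomial.coe_mul]; ring⟩

end Denominators

/-! ### Generating functions of states along the successor map. -/

section Series

open Necklace Polynomial

variable {N : ℕ} [NeZero N] {A B : Finset (ZMod N)}

/-- The generating function belonging to a state. -/
noncomputable def stateSeries (A B : Finset (ZMod N)) : PowerSeries ℤ :=
  PowerSeries.mk (stateCount A B)

/-- The iterated successors of a state. -/
noncomputable def iterState (A B : Finset (ZMod N)) : ℕ → Finset (ZMod N) × Finset (ZMod N)
  | 0 => (A, B)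
  | i + 1 => ((iterState A B i).2, successor (iterState A B i).1 (iterState A B i).2)

theorem IsState.iterState (h : IsState A B) (i : ℕ) :
    IsState (iterState A B i).1 (iterState A B i).2 := by
  induction i with
  | zero => exact h
  | succ i ih => exact ih.next

theorem IsState.card_runStarts_iterState (h : IsState A B) (i : ℕ) :
    (runStarts (_root_.iterState A B i).1).card = (runStarts A).card := by
  induction i with
  | zero => rfl
  | succ i ih => rw [← ih]; exact (h.iterState i).card_runStarts_eq

variable [Fact (1 < N)]

/-- In the recursion the term `R = ∅` is the successor, and all other terms have fewer runs, so `D`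
is a denominator for them. -/
theorem IsState.hasDenominator_sub (h : IsState A B) {D : ℤ[X]}
    (hD : ∀ A' B' : Finset (ZMod N), IsState A' B' → (runStarts A').card < (runStarts A).card →
      HasDenominator D (stateSeries A' B')) :
    HasDenominator D (stateSeries A B -
      ((C ((-1) ^ A.card) * X : ℤ[X]) : PowerSeries ℤ) * stateSeries B (successor A B)) := by
  classical
  have key : stateSeries A B = PowerSeries.C (stateCount A B 0) +
      PowerSeries.X * (PowerSeries.C ((-1) ^ A.card) *
        ∑ R ∈ (exchangeable A B).powerset,
          PowerSeries.C ((-1) ^ R.card) * stateSeries (B ∪ R) (successor A B \ R)) := by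
    rw [PowerSeries.eq_X_mul_shift_add_const (stateSeries A B), add_comm]
    refine congrArg₂ (· + ·) (by simp [stateSeries]) (congrArg (PowerSeries.X * ·) ?_)
    ext m
    rw [PowerSeries.coeff_mk, PowerSeries.coeff_C_mul, map_sum]
    simp only [PowerSeries.coeff_C_mul, stateSeries, PowerSeries.coeff_mk]
    exact stateCount_succ h m
  rw [← Finset.add_sum_erase _ _ (Finset.empty_mem_powerset (exchangeable A B))] at key
  have e : stateSeries A B -
      ((C ((-1) ^ A.card) * X : ℤ[X]) : PowerSeries ℤ) * stateSeries B (successor A B) =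
      ((C (stateCount A B 0) : ℤ[X]) : PowerSeries ℤ) +
      ((X * C ((-1) ^ A.card) : ℤ[X]) : PowerSeries ℤ) *
        ∑ R ∈ (exchangeable A B).powerset.erase ∅,
          ((C ((-1) ^ R.card) : ℤ[X]) : PowerSeries ℤ) *
            stateSeries (B ∪ R) (successor A B \ R) := by
    rw [key]
    simp only [Polynomial.coe_mul, Polynomial.coe_C, Polynomial.coe_X, Finset.card_empty, pow_zero,
      map_one, one_mul, Finset.union_empty, Finset.sdiff_empty]
    ring
  rw [e]
  refine (hasDenominator_coe _).add (HasDenominator.coe_mul (hasDenominator_sum fun R hR => ?_) _)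
  rw [Finset.mem_erase, Finset.mem_powerset] at hR
  exact (hD _ _ (h.union_successor_sdiff hR.2)
    (h.card_runStarts_union_lt hR.2 (Finset.nonempty_iff_ne_empty.2 hR.1))).coe_mul _

theorem IsState.hasDenominator_sub_iterState (h : IsState A B) {D : ℤ[X]}
    (hD : ∀ A' B' : Finset (ZMod N), IsState A' B' → (runStarts A').card < (runStarts A).card →
      HasDenominator D (stateSeries A' B')) (i j : ℕ) :
    ∃ e : ℕ, HasDenominator D
      (stateSeries (_root_.iterState A B i).1 (_root_.iterState A B i).2 -
      ((C ((-1) ^ e) * X ^ j : ℤ[X]) : PowerSeries ℤ) *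
        stateSeries (_root_.iterState A B (i + j)).1 (_root_.iterState A B (i + j)).2) := by
  induction j with
  | zero =>
    refine ⟨0, ?_⟩
    have := hasDenominator_coe (D := D) 0
    simpa using this
  | succ j ih =>
    obtain ⟨e, he⟩ := ih
    have h1 := (h.iterState (i + j)).hasDenominator_sub (D := D) fun A' B' h' hlt => by
      rw [h.card_runStarts_iterState] at hlt
      exact hD A' B' h' hlt
    refine ⟨e + (_root_.iterState A B (i + j)).1.card, ?_⟩
    convert he.add (h1.coe_mul (C ((-1) ^ e) * X ^ j)) using 1
    rw [← add_assoc, _root_.iterState]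
    simp only [Polynomial.coe_mul, Polynomial.coe_C, Polynomial.coe_X, Polynomial.coe_pow, pow_add,
      pow_one, map_mul]
    ring

theorem hasDenominator_of_sub {D : ℤ[X]} {f g : PowerSeries ℤ} {p E : ℤ[X]}
    (h : HasDenominator D (f - (p : PowerSeries ℤ) * g))
    (hg : HasDenominator D ((E : PowerSeries ℤ) * g)) :
    HasDenominator D ((E : PowerSeries ℤ) * f) := by
  convert (h.coe_mul E).add (hg.coe_mul p) using 1
  ring

/-- There are finitely many states, so the walk of necklace classes returns and contains a cycle.
Equal classes mean isometric necklaces, hence isometric states and equal series. -/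
theorem IsState.exists_period (h : IsState A B) (hk : 1 ≤ (runStarts A).card) :
    ∃ l, HasCycleOfLength (neckGraph (runStarts A).card N) l ∧ ∃ i,
      stateSeries (_root_.iterState A B i).1 (_root_.iterState A B i).2 =
      stateSeries (_root_.iterState A B (i + l)).1 (_root_.iterState A B (i + l)).2 := by
  have hneck : ∀ i, IsNecklace (runStarts A).card N
      (stones (_root_.iterState A B i).1 (_root_.iterState A B i).2) := fun i => by
    rw [← h.card_runStarts_iterState i]
    exact (h.iterState i).isNecklace_stones
  let a : ℕ → Class (runStarts A).card N := fun i => Quotient.mk _ ⟨_, hneck i⟩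
  have ha : ∀ i, (neckGraph (runStarts A).card N).Adj (a i) (a (i + 1)) := fun i =>
    ⟨⟨_, hneck i⟩, ⟨_, hneck (i + 1)⟩, rfl, rfl, (h.iterState i).transform_stones.symm⟩
  obtain ⟨i, j, hij, hs⟩ : ∃ i j, i < j ∧ _root_.iterState A B i = _root_.iterState A B j := by
    obtain ⟨i, j, hij, hs⟩ := Finite.exists_ne_map_eq_of_infinite (_root_.iterState A B)
    rcases hij.lt_or_gt with h1 | h1
    · exact ⟨i, j, h1, hs⟩
    · exact ⟨j, i, h1, hs.symm⟩
  have hcl : a i = a j := by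
    refine congrArg (Quotient.mk _) (Subtype.ext ?_)
    change stones (_root_.iterState A B i).1 (_root_.iterState A B i).2 =
      stones (_root_.iterState A B j).1 (_root_.iterState A B j).2
    rw [hs]
  obtain ⟨l, hl, i, hi⟩ := exists_hasCycleOfLength ha hij hcl
  refine ⟨l, hl, i, ?_⟩
  obtain ⟨ε, c, he⟩ := Quotient.exact hi
  have hne : (runStarts (_root_.iterState A B (i + l)).1).Nonempty := by
    rw [← Finset.card_pos, h.card_runStarts_iterState]
    exact hk
  rw [stateSeries, stateSeries,
    (h.iterState i).stateCount_eq_of_stones_eq (h.iterState (i + l)) hne he]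

/-- Once around the cycle, the series satisfies `F = ± t ^ l F` modulo denominator `D`. The sign is
not controlled, and the doubled exponent covers both: `1 - t ^ (2 * l)` is the product of `1 - t ^
l` and `1 + t ^ l`. -/
theorem IsState.hasDenominator_mul (h : IsState A B) (hk : 1 ≤ (runStarts A).card) {D : ℤ[X]}
    (hD : ∀ A' B' : Finset (ZMod N), IsState A' B' → (runStarts A').card < (runStarts A).card →
      HasDenominator D (stateSeries A' B')) {q : ℕ}
    (hq : ∀ l, HasCycleOfLength (neckGraph (runStarts A).card N) l → l ∣ q) :
    HasDenominator (D * (1 - X ^ (2 * q))) (stateSeries A B) := by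
  obtain ⟨l, hl, i, hi⟩ := h.exists_period hk
  obtain ⟨r, hr⟩ := hq l hl
  obtain ⟨e, h1⟩ := h.hasDenominator_sub_iterState hD i l
  obtain ⟨e', h2⟩ := h.hasDenominator_sub_iterState hD 0 i
  rw [← hi] at h1
  rw [zero_add] at h2
  refine HasDenominator.of_coe_mul (hasDenominator_of_sub h2 ?_)
  obtain ⟨p, hp⟩ : (1 - X ^ (2 * l) : ℤ[X]) ∣ 1 - X ^ (2 * q) := by
    rw [hr, ← mul_assoc, pow_mul _ (2 * l)]
    exact one_sub_dvd_one_sub_pow _ _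
  have h3 : (1 - X ^ (2 * q) : ℤ[X]) =
      (p * (1 + C ((-1) ^ e) * X ^ l)) * (1 - C ((-1) ^ e) * X ^ l) := by
    have h4 : (C ((-1 : ℤ) ^ e) : ℤ[X]) * C ((-1) ^ e) = 1 := by
      rw [← C_mul, ← mul_pow]
      simp
    rw [hp]
    linear_combination (p * X ^ (2 * l)) * h4
  rw [h3, Polynomial.coe_mul, mul_assoc]
  refine HasDenominator.coe_mul ?_ _
  convert h1 using 1
  rw [Polynomial.coe_sub, Polynomial.coe_one]
  ring

end Series

/-! ### The denominators of the Witten series. -/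

section Series

open Necklace Polynomial

variable {N : ℕ} [NeZero N] {A B : Finset (ZMod N)}

theorem hasDenominator_of_runStarts_eq_empty [Fact (1 < N)] (h : IsState A B)
    (hA : runStarts A = ∅) : HasDenominator (1 - C ((-1) ^ (N / 2)) * X ^ 2) (stateSeries A B) := by
  refine ⟨C (stateCount A B 0) + C (stateCount A B 1) * X, ?_⟩
  have key : stateSeries A B = PowerSeries.C (stateCount A B 0) +
      PowerSeries.X * (PowerSeries.C (stateCount A B 1) +
        PowerSeries.X * (PowerSeries.C ((-1) ^ (N / 2)) * stateSeries A B)) := by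
    ext m
    rcases m with _ | _ | m
    · simp [stateSeries]
    · rw [map_add, PowerSeries.coeff_succ_X_mul, PowerSeries.coeff_C]
      simp [stateSeries]
    · rw [map_add, PowerSeries.coeff_succ_X_mul, map_add, PowerSeries.coeff_succ_X_mul,
        PowerSeries.coeff_C_mul]
      simp only [stateSeries, PowerSeries.coeff_mk, PowerSeries.coeff_C, Nat.succ_ne_zero, if_false,
        zero_add]
      exact stateCount_add_two_of_runStarts_eq_empty h hA m
  simp only [Polynomial.coe_mul, Polynomial.coe_C, Polynomial.coe_X, Polynomial.coe_add,
    Polynomial.coe_sub, Polynomial.coe_one, Polynomial.coe_pow]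
  linear_combination key

theorem IsState.hasDenominator [Fact (1 < N)] (hN : CycleLengthsDivide N) (k : ℕ) :
    ∀ A B : Finset (ZMod N), IsState A B → (runStarts A).card ≤ k →
      HasDenominator ((1 - C ((-1) ^ (N / 2)) * X ^ 2) *
        ∏ j ∈ Finset.range k, (1 - X ^ (2 * (N - 3 * (j + 1))))) (stateSeries A B) := by
  induction k with
  | zero =>
    intro A B h hA
    simpa using hasDenominator_of_runStarts_eq_empty h (Finset.card_eq_zero.1 (Nat.le_zero.1 hA))
  | succ k ih =>
    intro A B h hA
    rw [Finset.prod_range_succ, ← mul_assoc]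
    rcases hA.lt_or_eq with hlt | heq
    · exact (ih A B h (Nat.lt_succ_iff.1 hlt)).of_dvd (dvd_mul_right _ _)
    · have h4 := h.four_mul_card_runStarts_le
      refine h.hasDenominator_mul (by omega) (fun A' B' h' hlt => ih A' B' h' (by omega))
        fun l hl => ?_
      have := hN _ (by omega) l hl
      rw [heq] at this h4
      -- The bound `4 * (k + 1) ≤ N` makes the truncated subtraction `N - 3 * (k + 1)` a true one.
      rw [← Int.natCast_dvd_natCast, Nat.cast_sub (by omega)]
      push_cast at *
      exact this

theorem hasDenominator_wittenSeries [Fact (1 < N)] (h2 : 2 ∣ N) (hN : CycleLengthsDivide N) :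
    HasDenominator ((1 - C ((-1) ^ (N / 2)) * X ^ 2) *
      ∏ j ∈ Finset.range (N / 4), (1 - X ^ (2 * (N - 3 * (j + 1))))) (wittenSeries N) := by
  obtain ⟨E, hE, hcount⟩ := raggedCount_empty h2
  have e : wittenSeries N = ∑ R ∈ E.powerset,
      ((C ((-1) ^ R.card) : ℤ[X]) : PowerSeries ℤ) * stateSeries R (E \ R) := by
    ext m
    rw [map_sum, wittenSeries, PowerSeries.coeff_mk, wittenIndex_cylinder, hcount]
    refine Finset.sum_congr rfl fun R _ => ?_
    rw [Polynomial.coe_C, PowerSeries.coeff_C_mul, stateSeries, PowerSeries.coeff_mk]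
  rw [e]
  refine hasDenominator_sum fun R hR => HasDenominator.coe_mul ?_ _
  have h := hE R (Finset.mem_powerset.1 hR)
  have h4 := h.four_mul_card_runStarts_le
  exact IsState.hasDenominator hN _ _ _ h (by omega)

/-- The empty graph has Witten index 1, so the series is `1 / (1 - t) = (1 + t) / (1 - t ^ 2)`. -/
theorem hasDenominator_wittenSeries_zero : HasDenominator (1 - X ^ 2) (wittenSeries 0) := by
  have h : wittenSeries 0 = PowerSeries.mk 1 := by
    ext m
    classical
    rw [wittenSeries, PowerSeries.coeff_mk, PowerSeries.coeff_mk, wittenIndex_eq_signedCount,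
      Finset.univ_eq_empty, signedCount_eq_sum_ite, Finset.powerset_empty, Finset.sum_singleton,
      if_pos (by simp [SimpleGraph.IsIndepSet])]
    rfl
  refine ⟨1 + X, ?_⟩
  rw [h, show (1 - X ^ 2 : ℤ[X]) = (1 - X) * (1 + X) by ring, Polynomial.coe_mul, ← mul_assoc,
    Polynomial.coe_sub, Polynomial.coe_one, Polynomial.coe_X,
    PowerSeries.mk_one_mul_one_sub_eq_one, one_mul]

end Series

theorem mainTheorem5 :
    (∀ n : ℕ, Necklace.CycleLengthsDivide (4 * n + 2) →
      ∃ h : Polynomial ℤ,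
        wittenSeries (4 * n + 2) *
          (((1 + Polynomial.X ^ 2) *
            ∏ j ∈ Finset.range n, (1 - Polynomial.X ^ (2 * n + 4 + 6 * j)) : Polynomial ℤ) :
            PowerSeries ℤ) = (h : PowerSeries ℤ)) ∧
    (∀ n : ℕ, (0 < n → Necklace.CycleLengthsDivide (4 * n)) →
      ∃ h : Polynomial ℤ,
        wittenSeries (4 * n) *
          (((1 - Polynomial.X ^ 2) *
            ∏ j ∈ Finset.range n, (1 - Polynomial.X ^ (2 * n + 6 * j)) : Polynomial ℤ) :
            PowerSeries ℤ) = (h : PowerSeries ℤ)) := by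
  refine ⟨fun n hN => ?_, fun n hN => ?_⟩
  · have : Fact (1 < 4 * n + 2) := ⟨by omega⟩
    have h := hasDenominator_wittenSeries (N := 4 * n + 2) (by omega) hN
    have h1 : (4 * n + 2) / 2 = 2 * n + 1 := by omega
    have h2 : (4 * n + 2) / 4 = n := by omega
    -- Reversing the product pairs `j` with `k = n - j` runs, and `2 * (4 * n + 2 - 3 * (n - j)) = 2
    -- * n + 4 + 6 * j`.
    rw [h1, h2, ← Finset.prod_range_reflect] at h
    change HasDenominator _ _
    convert h using 2
    · rw [Odd.neg_one_pow ⟨n, rfl⟩, Polynomial.C_neg, Polynomial.C_1]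
      ring
    · refine Finset.prod_congr rfl fun j hj => ?_
      have := Finset.mem_range.1 hj
      congr 2
      omega
  · rcases Nat.eq_zero_or_pos n with rfl | hn
    · change HasDenominator _ _
      simpa using hasDenominator_wittenSeries_zero
    · have : Fact (1 < 4 * n) := ⟨by omega⟩
      have : NeZero (4 * n) := ⟨by omega⟩
      have h := hasDenominator_wittenSeries (N := 4 * n) (by omega) (hN hn)
      have h1 : 4 * n / 2 = 2 * n := by omega
      have h2 : 4 * n / 4 = n := by omega
      rw [h1, h2, ← Finset.prod_range_reflect] at h
      change HasDenominator _ _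
      convert h using 2
      · rw [Even.neg_one_pow ⟨n, by ring⟩, Polynomial.C_1, one_mul]
      · refine Finset.prod_congr rfl fun j hj => ?_
        have := Finset.mem_range.1 hj
        congr 2
        omega
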